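/- Let $a\ge 3$ be an integer, $\Delta=2^a$, and let $C\le\mathbb F_2^n$ be a binary linear code of length $n$ with $3\Delta\le n\le 4\Delta$. Suppose that $C$ is full-length (no position is zero in all codewords) and that the set of Hamming weights of its non-zero codewords is exactly $\{\Delta,2\Delta,3\Delta\}$. Then $\dim C\le 2a+3$. If $\dim C=2a+3$, then $n\in\{4\Delta-1,4\Delta\}$, the code $C$ is projective (full-length, and any two distinct positions differ in some codeword), and the following holds. Here isomorphism of binary codes means equality up to a bijection of the positions, $W_C(x)=\sum_i A_i x^i$ where $A_i$ is the number of codewords of weight $i$, $\mathrm{Sim}_2(m)$ is the $m$-dimensional binary simplex code (positions: the non-zero vectors of $\mathbb F_2^m$; codewords: the linear forms), and $\mathrm{RM}_2(m+1)$ is the $(m+1)$-dimensional binary first order Reed–Muller code (positions: the vectors of $\mathbb F_2^m$; codewords: the affine functions). (i) If $n=4\Delta-1$, then $C\cong \mathrm{Sim}_2(a+1)\oplus \mathrm{RM}_2(a+2)$ and $$W_C(x)=1+(6\Delta-3)x^{\Delta}+(8\Delta^2-8\Delta+3)x^{2\Delta}+(2\Delta-1)x^{3\Delta}.$$ (ii)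 If $n=4\Delta$, let $R\in\mathbb F_2^{(a+1)\times 2\Delta}$ be any matrix such that $R$ with an all-one row $\mathbf 1$ appended at the bottom is a generator matrix of $\mathrm{RM}_2(a+2)$; let $r_1$ be the first row of $R$ and $R'$ the matrix of its remaining $a$ rows. Then $C$ is isomorphic to the code with generator matrix $$\begin{pmatrix} R & 0\\ \mathbf 1 & r_1\\ 0 & R'\\ 0 & \mathbf 1\end{pmatrix}\in\mathbb F_2^{(2a+3)\times 4\Delta},$$ which is a subcode of codimension $1$ of $\mathrm{RM}_2(a+2)\oplus\mathrm{RM}_2(a+2)$, and $$W_C(x)=1+(4\Delta-3)x^{\Delta}+(8\Delta^2-8\Delta+3)x^{2\Delta}+(4\Delta-1)x^{3\Delta}.$$ -/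

import Mathlib

/-- A binary linear code whose positions are indexed by `ι`; for `ι = Fin n` its length is `n`. -/
abbrev BinaryCode (ι : Type*) := Submodule (ZMod 2) (ι → ZMod 2)

namespace BinaryCode

/-- No position is identically zero. -/
def IsFullLength {ι : Type*} (C : BinaryCode ι) : Prop :=
  ∀ i, ∃ c ∈ C, c i ≠ 0

/-- Full-length, and no two distinct positions are projectively equivalent
(over the binary field the only scalar available is `1`). -/
def IsProjective {ι : Type*} (C : BinaryCode ι) : Prop :=
  C.IsFullLength ∧ ∀ i j, (∀ c ∈ C, c i = c j) → i = j

/-- The set of Hamming weights of the nonzero codewords. -/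
def nonzeroWeights {ι : Type*} [Fintype ι] (C : BinaryCode ι) : Set ℕ :=
  {w | ∃ c ∈ C, c ≠ 0 ∧ hammingNorm c = w}

/-- The weight enumerator `∑ A_i x^i`, with `A_i` the number of codewords of Hamming weight `i`. -/
noncomputable def weightEnumerator {ι : Type*} [Fintype ι] (C : BinaryCode ι) : Polynomial ℤ :=
  ∑ i ∈ Finset.range (Fintype.card ι + 1),
    Polynomial.monomial i (({c : ι → ZMod 2 | c ∈ C ∧ hammingNorm c = i}.ncard : ℕ) : ℤ)

/-- Two binary codes are isomorphic if a bijection between their positions carries one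
to the other. -/
def Isomorphic {ι κ : Type*} (C : BinaryCode ι) (D : BinaryCode κ) : Prop :=
  ∃ e : ι ≃ κ, ∀ c : κ → ZMod 2, c ∈ D ↔ c ∘ e ∈ C

/-- The direct sum: all concatenations of a codeword of `C` and a codeword of `D`. -/
def directSum {ι κ : Type*} (C : BinaryCode ι) (D : BinaryCode κ) : BinaryCode (ι ⊕ κ) where
  carrier := {c | c ∘ Sum.inl ∈ C ∧ c ∘ Sum.inr ∈ D}
  add_mem' := fun hx hy => ⟨C.add_mem hx.1 hy.1, D.add_mem hx.2 hy.2⟩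
  zero_mem' := ⟨C.zero_mem, D.zero_mem⟩
  smul_mem' := fun r _ hx => ⟨C.smul_mem r hx.1, D.smul_mem r hx.2⟩

/-- `G` is a generator matrix of `C`: its rows form a basis of `C`. -/
def IsGeneratorMatrix {ρ ι : Type*} (G : Matrix ρ ι (ZMod 2)) (C : BinaryCode ι) : Prop :=
  LinearIndependent (ZMod 2) G.row ∧ Submodule.span (ZMod 2) (Set.range G.row) = C

/-- The binary simplex code of dimension `m`: the positions are the points of the projective
space of `F_2^m`, i.e. the nonzero vectors, and the codewords are the linear forms. -/
def simplexCode (m : ℕ) : BinaryCode {v : Fin m → ZMod 2 // v ≠ 0} where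
  carrier := {f | ∃ x : Fin m → ZMod 2, ∀ v, f v = x ⬝ᵥ v.1}
  add_mem' := by
    rintro f g ⟨x, hx⟩ ⟨y, hy⟩
    exact ⟨x + y, fun v => by simp [hx, hy]⟩
  zero_mem' := ⟨0, fun v => by simp⟩
  smul_mem' := by
    rintro r f ⟨x, hx⟩
    exact ⟨r • x, fun v => by simp [hx]⟩

/-- The binary first order Reed-Muller code of length `2 ^ m` and dimension `m + 1`:
the positions are the points of the affine space `F_2^m` and the codewords are the
affine functions. -/
def reedMullerCode (m : ℕ) : BinaryCode (Fin m → ZMod 2) where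
  carrier := {f | ∃ (x : Fin m → ZMod 2) (b : ZMod 2), ∀ v, f v = x ⬝ᵥ v + b}
  add_mem' := by
    rintro f g ⟨x, b, hx⟩ ⟨y, d, hy⟩
    exact ⟨x + y, b + d, fun v => by simp [hx, hy]; ring⟩
  zero_mem' := ⟨0, 0, fun v => by simp⟩
  smul_mem' := by
    rintro r f ⟨x, b, hx⟩
    exact ⟨r • x, r * b, fun v => by simp [hx]; ring⟩

/-- The matrix `R` with an all-one row appended at the bottom. -/
def appendOnes {ρ κ : Type*} (R : Matrix ρ κ (ZMod 2)) : Matrix (ρ ⊕ Unit) κ (ZMod 2) :=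
  Matrix.fromRows R (Matrix.of fun _ _ => 1)

/-- The matrix with `2a+3` rows in which two copies of the block `appendOnes R` (of `a+2` rows)
are placed on two disjoint sets of columns and overlap in a single row: the last (all-one) row
of the left block continues the first row of the right block. All other entries are zero. -/
def overlapMatrix {a : ℕ} {κ : Type*} (R : Matrix (Fin (a + 1)) κ (ZMod 2)) :
    Matrix (Fin (a + 1) ⊕ (Fin (a + 1) ⊕ Unit)) (κ ⊕ κ) (ZMod 2) :=
  Matrix.fromCols
    (Matrix.fromRows R (Matrix.of fun i _ => if i = Sum.inl 0 then 1 else 0))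
    (Matrix.fromRows 0 (appendOnes R))

/-- The coordinate functions together with the all-one word form a generator matrix of the
first order Reed-Muller code. -/
theorem isGeneratorMatrix_coordinates (m : ℕ) :
    IsGeneratorMatrix (appendOnes (Matrix.of fun (i : Fin m) (v : Fin m → ZMod 2) => v i))
      (reedMullerCode m) := by
  constructor
  · rw [Fintype.linearIndependent_iff]
    intro g hg
    have h : ∀ v : Fin m → ZMod 2, ∑ i, g (Sum.inl i) * v i + g (Sum.inr ()) = 0 := by
      intro v
      have := congrFun hg v
      simpa [appendOnes, Matrix.row] using this
    have h0 : g (Sum.inr ()) = 0 := by simpa using h 0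
    rintro (i | u)
    · simpa [h0, Pi.single_apply] using h (Pi.single i 1)
    · exact h0
  · apply le_antisymm
    · rw [Submodule.span_le]
      rintro _ ⟨i | u, rfl⟩
      · exact ⟨Pi.single i 1, 0, fun v => by simp [appendOnes, Matrix.row]⟩
      · exact ⟨0, 1, fun v => by simp [appendOnes, Matrix.row]⟩
    · rintro f ⟨x, b, hf⟩
      rw [Submodule.mem_span_range_iff_exists_fun]
      refine ⟨Sum.elim x fun _ => b, ?_⟩
      ext v
      simp [appendOnes, Matrix.row, hf, dotProduct]

end BinaryCode

/-! The power moments force many words of weight Δ, while a code of length at most 4Δ has room for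
that many only if it contains large constant weight subcodes, and these are rigid.

Lower bound. Write n = 4Δ - s. If dim C ≥ 2a+3, eliminating the numbers of words of weight 2Δ and 3Δ
leaves at least 4Δ - 3 words of weight Δ. If there are at most 4Δ - 2 of them, then s = 0, the
dimension is 2a+3, the code is projective and the number is 4Δ - 3
(`ThreeWeight.moment_consequences`).

Upper bound. Let V be a largest subcode of constant weight Δ. Counting incidences with its support
shows that a word of weight Δ lies in V, or avoids supp V, or equals y + v with v in V and y a word
of weight 2Δ that is one on supp V (`ThreeWeight.word_cases`). Passing to the words that avoid supp
V and repeating, two layers exhaust the length. A layer contributes at most 2Δ - 1 words unless V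
has 2Δ words and some y exists, in which case V and y span a first order Reed–Muller code
(`ThreeWeight.exists_large_subcode`).

Rigidity. A constant weight code with 2Δ words is a simplex code: on 2Δ positions containing its
support its characters form an orthogonal basis. The weights in C make the Fourier coefficients of
every codeword on such a set multiples of Δ, and Parseval then makes its restriction affine
(`ConstantWeight.affine_of_divisible`). So C splits along supp y, and the dimension count and both
normal forms follow. A Reed–Muller subcode leads to length 4Δ - 1; otherwise the length is 4Δ. -/

namespace BinaryCode

open scoped Classical
open Finset

variable {ι : Type*} [Fintype ι]

/-! ### Supports, codewords and constant weight subcodes -/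

/-- The positions in which a word is nonzero. -/
def wordSupport (c : ι → ZMod 2) : Finset ι := {p | c p ≠ 0}

/-- The positions in which some codeword is nonzero. -/
noncomputable def codeSupport (V : BinaryCode ι) : Finset ι := {p | ∃ v ∈ V, v p ≠ 0}

/-- The finite set of codewords. -/
noncomputable def words (V : BinaryCode ι) : Finset (ι → ZMod 2) := {v | v ∈ V}

/-- The words vanishing on a set of positions. -/
def vanishingOn (T : Finset ι) : BinaryCode ι where
  carrier := {c | ∀ p ∈ T, c p = 0}
  add_mem' := fun hx hy p hp => by simp [hx p hp, hy p hp]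
  zero_mem' := fun _ _ => rfl
  smul_mem' := fun r _ hx p hp => by simp [hx p hp]

/-- The codewords of a given weight. -/
noncomputable def wordsOfWeight (C : BinaryCode ι) (w : ℕ) : Finset (ι → ZMod 2) :=
  {c | c ∈ C ∧ hammingNorm c = w}

/-- All nonzero codewords have the same weight `Δ`. -/
def ConstantWeight (Δ : ℕ) (V : BinaryCode ι) : Prop := ∀ v ∈ V, v ≠ 0 → hammingNorm v = Δ

/-- All nonzero codewords have weight `Δ`, `2Δ` or `3Δ`. -/
def ThreeWeight (Δ : ℕ) (C : BinaryCode ι) : Prop :=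
  ∀ c ∈ C, c ≠ 0 → hammingNorm c = Δ ∨ hammingNorm c = 2 * Δ ∨ hammingNorm c = 3 * Δ

theorem mem_wordSupport {c : ι → ZMod 2} {p : ι} : p ∈ wordSupport c ↔ c p ≠ 0 := by
  simp [wordSupport]

theorem mem_codeSupport {V : BinaryCode ι} {p : ι} : p ∈ codeSupport V ↔ ∃ v ∈ V, v p ≠ 0 := by
  simp [codeSupport]

theorem mem_words {V : BinaryCode ι} {v : ι → ZMod 2} : v ∈ words V ↔ v ∈ V := by simp [words]

omit [Fintype ι] in
theorem mem_vanishingOn {T : Finset ι} {c : ι → ZMod 2} :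
    c ∈ vanishingOn T ↔ ∀ p ∈ T, c p = 0 := Iff.rfl

theorem mem_wordsOfWeight {C : BinaryCode ι} {w : ℕ} {c : ι → ZMod 2} :
    c ∈ wordsOfWeight C w ↔ c ∈ C ∧ hammingNorm c = w := by simp [wordsOfWeight]

theorem hammingNorm_eq_card (c : ι → ZMod 2) : hammingNorm c = #(wordSupport c) := rfl

theorem ThreeWeight.mono {Δ : ℕ} {C D : BinaryCode ι} (h : ThreeWeight Δ C) (hD : D ≤ C) :
    ThreeWeight Δ D := fun c hc => h c (hD hc)

theorem ConstantWeight.mono {Δ : ℕ} {C D : BinaryCode ι} (h : ConstantWeight Δ C) (hD : D ≤ C) :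
    ConstantWeight Δ D := fun c hc => h c (hD hc)

theorem card_words (V : BinaryCode ι) : #(words V) = 2 ^ Module.finrank (ZMod 2) V := by
  have h := Module.card_eq_pow_finrank (K := ZMod 2) (V := V)
  rw [ZMod.card] at h
  rw [← h, words, Fintype.card_subtype]

theorem words_mono {V W : BinaryCode ι} (h : V ≤ W) : words V ⊆ words W := fun _ hv =>
  mem_words.2 (h (mem_words.1 hv))

theorem eq_one_of_ne_zero {x : ZMod 2} (h : x ≠ 0) : x = 1 := by
  revert x; decide

theorem zmod_two_add_self (x : ZMod 2) : x + x = 0 := by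
  revert x; decide

omit [Fintype ι] in
theorem add_self (c : ι → ZMod 2) : c + c = 0 := funext fun _ => zmod_two_add_self _

omit [Fintype ι] in
theorem add_add_cancel_self (c d : ι → ZMod 2) : c + d + d = c := by
  rw [add_assoc, add_self, add_zero]

/-! ### Character sums, incidence counting and Parseval's identity -/

/-- The nontrivial additive character of the field with two elements. -/
def sgn (x : ZMod 2) : ℤ := if x = 0 then 1 else -1

theorem sgn_zero : sgn 0 = 1 := rfl

theorem sgn_add (x y : ZMod 2) : sgn (x + y) = sgn x * sgn y := by
  revert x y; decide

theorem sgn_of_ne {x : ZMod 2} (h : x ≠ 0) : sgn x = -1 := by simp [sgn, h]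

/-- Orthogonality of characters: translation by a word on which `φ` is nonzero permutes the code and
flips every sign. -/
theorem sum_sgn_linear (V : BinaryCode ι) (φ : (ι → ZMod 2) →ₗ[ZMod 2] ZMod 2) :
    ∑ v ∈ words V, sgn (φ v) = if ∀ v ∈ V, φ v = 0 then (#(words V) : ℤ) else 0 := by
  split_ifs with h
  · rw [sum_congr rfl fun v hv => by rw [h v (mem_words.1 hv), sgn_zero]]
    simp
  · push Not at h
    obtain ⟨w, hw, hφ⟩ := h
    have h1 : ∑ v ∈ words V, sgn (φ v) = ∑ v ∈ words V, sgn (φ (v + w)) := by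
      refine sum_bij' (fun v _ => v + w) (fun v _ => v + w) ?_ ?_ ?_ ?_ ?_
      · intro v hv
        exact mem_words.2 (V.add_mem (mem_words.1 hv) hw)
      · intro v hv
        exact mem_words.2 (V.add_mem (mem_words.1 hv) hw)
      · intro v _
        exact add_add_cancel_self v w
      · intro v _
        exact add_add_cancel_self v w
      · intro v _
        simp [add_add_cancel_self]
    have h2 : ∑ v ∈ words V, sgn (φ (v + w)) = -∑ v ∈ words V, sgn (φ v) := by
      rw [← sum_neg_distrib]
      refine sum_congr rfl fun v _ => ?_
      rw [map_add, sgn_add, sgn_of_ne hφ]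
      ring
    linarith

theorem sum_sgn_eq_card (T : Finset ι) (c : ι → ZMod 2) :
    ∑ p ∈ T, sgn (c p) = (#T : ℤ) - 2 * #(T ∩ wordSupport c) := by
  have h : ∀ p, sgn (c p) = 1 - 2 * (if c p ≠ 0 then 1 else 0) := by
    intro p
    by_cases hp : c p = 0 <;> simp [sgn, hp]
  simp only [h, sum_sub_distrib, ← mul_sum, sum_boole]
  congr 3
  · simp
  · congr 1
    ext p
    simp [mem_wordSupport]

/-- Double counting of incidences between the codewords and the positions of `T`. -/
theorem two_mul_sum_card_inter (V : BinaryCode ι) (T : Finset ι) :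
    2 * ∑ v ∈ words V, #(T ∩ wordSupport v) = #(words V) * #(T ∩ codeSupport V) := by
  have h1 : ∑ v ∈ words V, ∑ p ∈ T, sgn (v p)
      = #(words V) * #T - 2 * ∑ v ∈ words V, (#(T ∩ wordSupport v) : ℤ) := by
    simp only [sum_sgn_eq_card, sum_sub_distrib, ← mul_sum]
    simp
  have h2 : ∑ v ∈ words V, ∑ p ∈ T, sgn (v p)
      = #(words V) * #T - #(words V) * #(T ∩ codeSupport V) := by
    rw [sum_comm]
    have h3 : ∀ p, ∑ v ∈ words V, sgn (v p)
        = #(words V) - #(words V) * (if p ∈ codeSupport V then 1 else 0) := by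
      intro p
      by_cases hp : ∀ v ∈ V, v p = 0
      · have hn : p ∉ codeSupport V := by simpa [mem_codeSupport] using hp
        have := (sum_sgn_linear V (LinearMap.proj p)).trans (if_pos hp)
        simpa [hn] using this
      · have hn : p ∈ codeSupport V := by simpa [mem_codeSupport] using hp
        have := (sum_sgn_linear V (LinearMap.proj p)).trans (if_neg hp)
        simpa [hn] using this
    simp only [h3, sum_sub_distrib, ← mul_sum, sum_boole]
    rw [filter_mem_eq_inter]
    simp [mul_comm]
  have : (2 * ∑ v ∈ words V, (#(T ∩ wordSupport v) : ℤ)) = #(words V) * #(T ∩ codeSupport V) := by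
    linarith
  exact_mod_cast this

/-- Parseval's identity for the coset of a word modulo a code, restricted to the positions `T`. -/
theorem parseval (V : BinaryCode ι) (T : Finset ι) (f : ι → ZMod 2) :
    ∑ v ∈ words V, (∑ p ∈ T, sgn (f p + v p)) ^ 2
      = #(words V) * ∑ p ∈ T, ∑ q ∈ T,
          if ∀ v ∈ V, v p = v q then sgn (f p) * sgn (f q) else 0 := by
  simp only [sq, sum_mul_sum]
  rw [sum_comm, mul_sum]
  refine sum_congr rfl fun p _ => ?_
  rw [sum_comm, mul_sum]
  refine sum_congr rfl fun q _ => ?_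
  have h := sum_sgn_linear V ((LinearMap.proj p : (ι → ZMod 2) →ₗ[ZMod 2] ZMod 2) +
    (LinearMap.proj q : (ι → ZMod 2) →ₗ[ZMod 2] ZMod 2))
  simp only [LinearMap.add_apply, LinearMap.proj_apply] at h
  have hiff : (∀ v ∈ V, v p + v q = 0) ↔ ∀ v ∈ V, v p = v q :=
    forall₂_congr fun _ _ => CharTwo.add_eq_zero
  have h1 : ∑ v ∈ words V, sgn (f p + v p) * sgn (f q + v q)
      = sgn (f p) * sgn (f q) * ∑ v ∈ words V, sgn (v p + v q) := by
    rw [mul_sum]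
    refine sum_congr rfl fun v _ => ?_
    simp only [sgn_add]
    ring
  rw [h1, h]
  simp only [hiff]
  split_ifs <;> ring

/-! ### Words of minimum weight relative to a maximal constant weight subcode -/

theorem zero_mem_words (V : BinaryCode ι) : 0 ∈ words V := mem_words.2 V.zero_mem

theorem wordSupport_subset_codeSupport {V : BinaryCode ι} {v : ι → ZMod 2} (hv : v ∈ V) :
    wordSupport v ⊆ codeSupport V := fun _ hp => mem_codeSupport.2 ⟨v, hv, mem_wordSupport.1 hp⟩

/-- The support of a code of constant weight. -/
theorem ConstantWeight.card_mul_card_codeSupport {Δ : ℕ} {V : BinaryCode ι}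
    (hV : ConstantWeight Δ V) :
    #(words V) * #(codeSupport V) = 2 * ((#(words V) - 1) * Δ) := by
  have h := two_mul_sum_card_inter V univ
  simp only [univ_inter] at h
  rw [← h, ← sum_erase_add _ _ (zero_mem_words V)]
  have h0 : #(wordSupport (0 : ι → ZMod 2)) = 0 := by simp [wordSupport]
  rw [h0, sum_congr rfl (g := fun _ => Δ), sum_const, card_erase_of_mem (zero_mem_words V)]
  · simp
  · intro v hv
    rw [mem_erase] at hv
    exact hV v (mem_words.1 hv.2) hv.1

theorem hammingNorm_add (x y : ι → ZMod 2) :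
    hammingNorm (x + y) + 2 * #(wordSupport x ∩ wordSupport y) = hammingNorm x + hammingNorm y := by
  have e : wordSupport (x + y) = symmDiff (wordSupport x) (wordSupport y) := by
    ext p
    rw [mem_symmDiff, mem_wordSupport, mem_wordSupport, mem_wordSupport, Pi.add_apply]
    generalize x p = s
    generalize y p = t
    revert s t
    decide
  simp only [hammingNorm_eq_card, e]
  rw [symmDiff_def, sup_eq_union, card_union_of_disjoint disjoint_sdiff_sdiff]
  have a1 := card_sdiff_add_card_inter (wordSupport x) (wordSupport y)
  have a2 := card_sdiff_add_card_inter (wordSupport y) (wordSupport x)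
  rw [inter_comm] at a2
  omega

/-- The sum has weight 2Δ minus twice the overlap, and only Δ and 2Δ are possible nonzero weights
that small. -/
theorem ThreeWeight.card_inter {Δ : ℕ} {C : BinaryCode ι} (hC : ThreeWeight Δ C)
    {x y : ι → ZMod 2} (hx : x ∈ C) (hy : y ∈ C) (hxw : hammingNorm x = Δ)
    (hyw : hammingNorm y = Δ) (hxy : x ≠ y) :
    #(wordSupport x ∩ wordSupport y) = 0 ∨ 2 * #(wordSupport x ∩ wordSupport y) = Δ := by
  have h := hammingNorm_add x y
  have hne : x + y ≠ 0 := fun h0 => hxy (by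
    rw [← add_add_cancel_self x y, h0, zero_add])
  rcases hC (x + y) (C.add_mem hx hy) hne with h1 | h1 | h1 <;> omega

theorem card_inter_eq_zero_iff {x v : ι → ZMod 2} :
    #(wordSupport x ∩ wordSupport v) = 0 ↔ v ∈ vanishingOn (wordSupport x) := by
  rw [card_eq_zero, ← disjoint_iff_inter_eq_empty, disjoint_left, mem_vanishingOn]
  simp [mem_wordSupport]

theorem one_lt_card_words {V : BinaryCode ι} {v : ι → ZMod 2} (hv : v ∈ V) (h0 : v ≠ 0) :
    1 < #(words V) := one_lt_card.2 ⟨v, mem_words.2 hv, 0, zero_mem_words V, h0⟩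

theorem exists_ne_zero_of_one_lt_card_words {V : BinaryCode ι} (h : 1 < #(words V)) :
    ∃ v ∈ V, v ≠ 0 := by
  obtain ⟨v, hv, h0⟩ := exists_mem_ne h 0
  exact ⟨v, mem_words.1 hv, h0⟩

theorem card_words_pos (V : BinaryCode ι) : 0 < #(words V) :=
  card_pos.2 ⟨0, zero_mem_words V⟩

/-- Arithmetic of `ThreeWeight.word_cases`, with M = |V|, K the number of words of V disjoint from
x, u and u₀ the two support sizes and i the overlap of x with supp V. After dividing out, the
inequality reads (M - K)/M ≤ 2(M - K)/(KM), that is K ≤ 2, so the slack f vanishes as well. -/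
theorem card_eq_two_of_incidences {M K i u u₀ Δ : ℕ} (hΔ : 0 < Δ) (hK : 2 ≤ K)
    (hKM : K < M) (hi : M * i = (M - K) * Δ) (hu : M * u = 2 * ((M - 1) * Δ))
    (hu₀ : K * u₀ = 2 * ((K - 1) * Δ)) (h : i + u₀ ≤ u) : K = 2 ∧ i + u₀ = u := by
  obtain ⟨d, rfl⟩ := Nat.exists_eq_add_of_lt hKM
  obtain ⟨e, rfl⟩ := Nat.exists_eq_add_of_le hK
  simp only [show 2 + e + d + 1 - (2 + e) = d + 1 by omega,
    show 2 + e + d + 1 - 1 = 2 + e + d by omega, show 2 + e - 1 = e + 1 by omega] at hi hu hu₀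
  obtain ⟨f, hf⟩ := Nat.exists_eq_add_of_le h
  have key : e * (d + 1) * Δ + f * ((2 + e) * (2 + e + d + 1)) = 0 := by
    zify at *
    linear_combination (2 + e : ℤ) * hu - (2 + e : ℤ) * hi - (2 + e + d + 1 : ℤ) * hu₀
      - ((2 + e) * (2 + e + d + 1) : ℤ) * hf
  rw [Nat.add_eq_zero_iff] at key
  have he : e = 0 := by
    have := key.1
    simp at this
    omega
  have hf0 : f = 0 := by
    have := key.2
    simp at this
    omega
  omega

/-- A word of minimum weight is contained in a given maximal constant weight subcode `V`, or
disjoint from it, or the difference of a nonzero word of `V` and a word which is constantly one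
on the support of `V`. -/
theorem ThreeWeight.word_cases {Δ : ℕ} (hΔ : 0 < Δ) {C V : BinaryCode ι} (hC : ThreeWeight Δ C)
    (hVC : V ≤ C) (hV : ConstantWeight Δ V)
    (hmax : ∀ W ≤ C, ConstantWeight Δ W → #(words W) ≤ #(words V))
    {x : ι → ZMod 2} (hx : x ∈ C) (hxw : hammingNorm x = Δ) (hxV : x ∉ V) :
    x ∈ vanishingOn (codeSupport V) ∨ (2 < #(words V) ∧ ∃ v ∈ V, v ≠ 0 ∧ ∃ y ∈ C,
      hammingNorm y = 2 * Δ ∧ (∀ p ∈ codeSupport V, y p = 1) ∧ x = y + v) := by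
  set V₀ := V ⊓ vanishingOn (wordSupport x) with hV₀
  have hV₀V : V₀ ≤ V := inf_le_left
  have hinter : ∀ v ∈ V, v ∉ V₀ → 2 * #(wordSupport x ∩ wordSupport v) = Δ := by
    intro v hv hv0
    have hvne : v ≠ 0 := fun h => hv0 (h ▸ V₀.zero_mem)
    rcases hC.card_inter hx (hVC hv) hxw (hV v hv hvne) (fun h => hxV (h ▸ hv)) with h | h
    · exact absurd ⟨hv, card_inter_eq_zero_iff.1 h⟩ hv0
    · exact h
  have hcount : #(words V) * #(wordSupport x ∩ codeSupport V)
      = (#(words V) - #(words V₀)) * Δ := by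
    rw [← two_mul_sum_card_inter, ← sum_sdiff (words_mono hV₀V), mul_add, mul_sum, mul_sum,
      sum_congr (s₁ := words V₀) (g := fun _ => 0) rfl, sum_congr rfl (g := fun _ => Δ)]
    · rw [sum_const, sum_const_zero, card_sdiff_of_subset (words_mono hV₀V)]
      simp
    · intro v hv
      rw [mem_sdiff, mem_words, mem_words] at hv
      exact hinter v hv.1 hv.2
    · intro v hv
      rw [card_inter_eq_zero_iff.2 (mem_words.1 hv).2, mul_zero]
  have hu := hV.card_mul_card_codeSupport
  have hu₀ := (hV.mono hV₀V).card_mul_card_codeSupport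
  have hsub : codeSupport V₀ ⊆ codeSupport V := fun p hp => by
    obtain ⟨v, hv, hvp⟩ := mem_codeSupport.1 hp
    exact mem_codeSupport.2 ⟨v, hV₀V hv, hvp⟩
  have hdisj : wordSupport x ∩ codeSupport V ⊆ codeSupport V \ codeSupport V₀ := by
    intro p hp
    rw [mem_inter] at hp
    refine mem_sdiff.2 ⟨hp.2, fun h => ?_⟩
    obtain ⟨v, hv, hvp⟩ := mem_codeSupport.1 h
    exact hvp (hv.2 p hp.1)
  have hle : #(wordSupport x ∩ codeSupport V) + #(codeSupport V₀) ≤ #(codeSupport V) := by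
    have h1 := card_le_card hdisj
    have h2 := card_sdiff_add_card_eq_card hsub
    omega
  -- If x met every nonzero word of V, all these overlaps would be Δ/2 and adjoining x would give a
  -- larger constant weight code.
  have hK : 2 ≤ #(words V₀) := by
    by_contra hlt
    have h1 : #(words V₀) ≤ 1 := by omega
    have htriv : ∀ v ∈ V, v ≠ 0 → 2 * #(wordSupport x ∩ wordSupport v) = Δ := by
      intro v hv hv0
      refine hinter v hv fun hmem => ?_
      have := one_lt_card_words hmem hv0
      omega
    have hW : ConstantWeight Δ (V ⊔ Submodule.span (ZMod 2) {x}) := by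
      intro w hw hw0
      obtain ⟨v, hv, z, hz, rfl⟩ := Submodule.mem_sup.1 hw
      obtain ⟨b, rfl⟩ := Submodule.mem_span_singleton.1 hz
      by_cases hb : b = 0
      · subst hb
        rw [zero_smul, add_zero] at hw0 ⊢
        exact hV v hv hw0
      · rw [eq_one_of_ne_zero hb, one_smul]
        by_cases hv0 : v = 0
        · rw [hv0, zero_add, hxw]
        · have h2 := htriv v hv hv0
          have h3 := hammingNorm_add v x
          rw [hV v hv hv0, hxw, inter_comm] at h3
          omega
    have hWC : V ⊔ Submodule.span (ZMod 2) {x} ≤ C :=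
      sup_le hVC ((Submodule.span_singleton_le_iff_mem _ _).2 hx)
    have hss : words V ⊂ words (V ⊔ Submodule.span (ZMod 2) {x}) := by
      refine ssubset_iff_of_subset (words_mono le_sup_left) |>.2 ⟨x, mem_words.2 ?_, ?_⟩
      · exact Submodule.mem_sup_right (Submodule.mem_span_singleton_self x)
      · rwa [mem_words]
    have := card_lt_card hss
    have := hmax _ hWC hW
    omega
  rcases (card_le_card (words_mono hV₀V)).eq_or_lt with hKM | hKM
  · left
    rw [hKM, Nat.sub_self, zero_mul, Nat.mul_eq_zero] at hcount
    have h0 := hcount.resolve_left (card_words_pos V).ne'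
    rw [card_eq_zero, ← disjoint_iff_inter_eq_empty, disjoint_right] at h0
    intro p hp
    have := h0 hp
    rwa [mem_wordSupport, not_not] at this
  · right
    obtain ⟨hK2, hadd⟩ := card_eq_two_of_incidences hΔ hK hKM hcount hu hu₀ hle
    refine ⟨by omega, ?_⟩
    obtain ⟨v, hv, hv0⟩ := exists_ne_zero_of_one_lt_card_words hK
    have hvV := hV₀V hv
    have hvw := hV v hvV hv0
    -- Equality in the count: x covers exactly the part of supp V outside supp v, so x + v is one on
    -- all of supp V.
    have heq : wordSupport x ∩ codeSupport V = codeSupport V \ wordSupport v := by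
      refine eq_of_subset_of_card_le (fun p hp => ?_) ?_
      · have h := hdisj hp
        rw [mem_sdiff] at h ⊢
        exact ⟨h.1, fun h' => h.2 (wordSupport_subset_codeSupport hv h')⟩
      · have h2 := card_sdiff_add_card_eq_card (wordSupport_subset_codeSupport hvV)
        rw [← hammingNorm_eq_card, hvw] at h2
        rw [hK2] at hu₀
        omega
    refine ⟨v, hvV, hv0, x + v, C.add_mem hx (hVC hvV), ?_, ?_, ?_⟩
    · have h3 := hammingNorm_add x v
      rw [card_inter_eq_zero_iff.2 hv.2] at h3
      omega
    · intro p hp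
      rw [Finset.ext_iff] at heq
      have h := heq p
      simp only [mem_inter, mem_sdiff, mem_wordSupport, hp, and_true, true_and] at h
      rw [Pi.add_apply]
      revert h
      generalize x p = s
      generalize v p = t
      revert s t
      decide
    · exact (add_add_cancel_self x v).symm

/-! ### Counting the words of minimum weight layer by layer -/

/-- A subcode of constant weight `Δ` with the maximal number of codewords. -/
structure IsMaxConstantWeight (Δ : ℕ) (C V : BinaryCode ι) : Prop where
  le : V ≤ C
  constantWeight : ConstantWeight Δ V
  card_le : ∀ W ≤ C, ConstantWeight Δ W → #(words W) ≤ #(words V)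

theorem exists_isMaxConstantWeight (Δ : ℕ) (C : BinaryCode ι) :
    ∃ V, IsMaxConstantWeight Δ C V := by
  obtain ⟨V, hV, hmax⟩ := Set.exists_max_image {V : BinaryCode ι | V ≤ C ∧ ConstantWeight Δ V}
    (fun V => #(words V)) (Set.toFinite _)
    ⟨⊥, bot_le, fun v hv h0 => absurd ((Submodule.mem_bot _).1 hv) h0⟩
  exact ⟨V, hV.1, hV.2, fun W h1 h2 => hmax W ⟨h1, h2⟩⟩

/-- The words of weight `2Δ` which are constantly one on the support of `V`. -/
noncomputable def wordsOver (Δ : ℕ) (C V : BinaryCode ι) : Finset (ι → ZMod 2) :=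
  {y | y ∈ C ∧ hammingNorm y = 2 * Δ ∧ ∀ p ∈ codeSupport V, y p = 1}

theorem mem_wordsOver {Δ : ℕ} {C V : BinaryCode ι} {y : ι → ZMod 2} :
    y ∈ wordsOver Δ C V ↔
      y ∈ C ∧ hammingNorm y = 2 * Δ ∧ ∀ p ∈ codeSupport V, y p = 1 := by simp [wordsOver]

/-- The codewords vanishing on the support of `V`. -/
noncomputable def awayFrom (C V : BinaryCode ι) : BinaryCode ι := C ⊓ vanishingOn (codeSupport V)

theorem awayFrom_le (C V : BinaryCode ι) : awayFrom C V ≤ C := inf_le_left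

theorem codeSupport_mono {V C : BinaryCode ι} (h : V ≤ C) : codeSupport V ⊆ codeSupport C :=
  fun p hp => by
    obtain ⟨v, hv, hvp⟩ := mem_codeSupport.1 hp
    exact mem_codeSupport.2 ⟨v, h hv, hvp⟩

theorem disjoint_codeSupport_awayFrom (C V : BinaryCode ι) :
    Disjoint (codeSupport (awayFrom C V)) (codeSupport V) := by
  rw [disjoint_left]
  intro p hp hpV
  obtain ⟨v, hv, hvp⟩ := mem_codeSupport.1 hp
  exact hvp (hv.2 p hpV)

theorem card_codeSupport_awayFrom {C V : BinaryCode ι} (h : V ≤ C) :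
    #(codeSupport (awayFrom C V)) + #(codeSupport V) ≤ #(codeSupport C) := by
  rw [← card_union_of_disjoint (disjoint_codeSupport_awayFrom C V)]
  exact card_le_card (union_subset (codeSupport_mono inf_le_left) (codeSupport_mono h))

/-- In M·|supp V| = 2(M - 1)Δ the factor M is coprime to M - 1. -/
theorem ConstantWeight.card_words_dvd {Δ : ℕ} {V : BinaryCode ι} (hV : ConstantWeight Δ V) :
    #(words V) ∣ 2 * Δ := by
  have h := hV.card_mul_card_codeSupport
  have hpos := card_words_pos V
  have hco : Nat.Coprime #(words V) (#(words V) - 1) := by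
    rw [Nat.coprime_comm]
    have h2 := Nat.coprime_self_add_right (m := #(words V) - 1) (n := 1)
    rw [Nat.sub_add_cancel hpos] at h2
    exact h2.2 (Nat.coprime_one_right _)
  refine hco.dvd_of_dvd_mul_left (n := 2 * Δ) ⟨#(codeSupport V), ?_⟩
  rw [h]
  ring

theorem ThreeWeight.card_wordsOfWeight_le {Δ : ℕ} (hΔ : 0 < Δ) {C V : BinaryCode ι}
    (hC : ThreeWeight Δ C) (hV : IsMaxConstantWeight Δ C V) :
    #(wordsOfWeight C Δ) ≤ (#(words V) - 1) * (1 + #(wordsOver Δ C V))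
      + #(wordsOfWeight (awayFrom C V) Δ) := by
  have hsub : wordsOfWeight C Δ ⊆ ((words V).erase 0 ∪
      image₂ (· + ·) (wordsOver Δ C V) ((words V).erase 0)) ∪
        wordsOfWeight (awayFrom C V) Δ := by
    intro x hx
    rw [mem_wordsOfWeight] at hx
    simp only [mem_union, mem_erase, mem_words, mem_image₂, mem_wordsOver, mem_wordsOfWeight]
    by_cases hxV : x ∈ V
    · refine Or.inl (Or.inl ⟨fun h => ?_, hxV⟩)
      rw [h, hammingNorm_zero] at hx
      omega
    · rcases hC.word_cases hΔ hV.le hV.constantWeight hV.card_le hx.1 hx.2 hxV with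
        h | ⟨-, v, hv, hv0, y, hy, hyw, hy1, rfl⟩
      · exact Or.inr ⟨⟨hx.1, h⟩, hx.2⟩
      · exact Or.inl (Or.inr ⟨y, ⟨hy, hyw, hy1⟩, v, ⟨hv0, hv⟩, rfl⟩)
  have h1 := (card_le_card hsub).trans (card_union_le _ _)
  have h2 := card_union_le ((words V).erase 0)
    (image₂ (· + ·) (wordsOver Δ C V) ((words V).erase 0))
  have h3 := card_image₂_le (· + ·) (wordsOver Δ C V) ((words V).erase 0)
  rw [card_erase_of_mem (zero_mem_words V)] at h2 h3
  rw [mul_add, mul_one, mul_comm (#(words V) - 1) #(wordsOver Δ C V)]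
  omega

theorem ThreeWeight.card_wordsOfWeight_le_of_card_eq_two {Δ : ℕ} (hΔ : 0 < Δ)
    {C V : BinaryCode ι} (hC : ThreeWeight Δ C) (hV : IsMaxConstantWeight Δ C V)
    (hV2 : #(words V) ≤ 2) :
    #(wordsOfWeight C Δ) ≤ 1 + #(wordsOfWeight (awayFrom C V) Δ) := by
  have hsub : wordsOfWeight C Δ ⊆ (words V).erase 0 ∪ wordsOfWeight (awayFrom C V) Δ := by
    intro x hx
    rw [mem_wordsOfWeight] at hx
    simp only [mem_union, mem_erase, mem_words, mem_wordsOfWeight]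
    by_cases hxV : x ∈ V
    · refine Or.inl ⟨fun h => ?_, hxV⟩
      rw [h, hammingNorm_zero] at hx
      omega
    · rcases hC.word_cases hΔ hV.le hV.constantWeight hV.card_le hx.1 hx.2 hxV with h | ⟨h, -⟩
      · exact Or.inr ⟨⟨hx.1, h⟩, hx.2⟩
      · omega
  have h1 := (card_le_card hsub).trans (card_union_le _ _)
  rw [card_erase_of_mem (zero_mem_words V)] at h1
  omega

theorem codeSupport_subset_inter {Δ : ℕ} {C V : BinaryCode ι} {y z : ι → ZMod 2}
    (hy : y ∈ wordsOver Δ C V) (hz : z ∈ wordsOver Δ C V) :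
    codeSupport V ⊆ wordSupport y ∩ wordSupport z := fun p hp => by
  simp [mem_wordSupport, (mem_wordsOver.1 hy).2.2 p hp, (mem_wordsOver.1 hz).2.2 p hp]

theorem ThreeWeight.le_hammingNorm {Δ : ℕ} {C : BinaryCode ι} (hC : ThreeWeight Δ C)
    {c : ι → ZMod 2} (hc : c ∈ C) (h0 : c ≠ 0) : Δ ≤ hammingNorm c := by
  rcases hC c hc h0 with h | h | h <;> omega

omit [Fintype ι] in
theorem add_ne_zero_of_ne {y z : ι → ZMod 2} (h : y ≠ z) : y + z ≠ 0 := fun h0 => h (by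
  rw [← add_add_cancel_self y z, h0, zero_add])

/-- Two such words overlap in at most 3Δ/2 positions, since their sum has weight at least Δ. But
both contain supp V, which has size 2Δ(1 - 1/M) > 3Δ/2 for M > 4. -/
theorem ThreeWeight.card_wordsOver_le_one {Δ : ℕ} (hΔ : 0 < Δ) {C V : BinaryCode ι}
    (hC : ThreeWeight Δ C) (hV : ConstantWeight Δ V) (h4 : 4 < #(words V)) :
    #(wordsOver Δ C V) ≤ 1 := by
  refine card_le_one.2 fun y hy z hz => ?_
  by_contra hyz
  have h1 := hC.le_hammingNorm (C.add_mem (mem_wordsOver.1 hy).1 (mem_wordsOver.1 hz).1)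
    (add_ne_zero_of_ne hyz)
  have h2 := hammingNorm_add y z
  rw [(mem_wordsOver.1 hy).2.1, (mem_wordsOver.1 hz).2.1] at h2
  have h3 := card_le_card (codeSupport_subset_inter hy hz)
  have h5 := hV.card_mul_card_codeSupport
  obtain ⟨m, hm⟩ := Nat.exists_eq_add_of_lt h4
  rw [hm] at h5
  simp only [Nat.add_sub_cancel] at h5
  nlinarith [Nat.mul_le_mul_left (4 + m + 1) (show 2 * #(codeSupport V) ≤ 3 * Δ by omega)]

/-- In this borderline case two words meet exactly in supp V, so their remainders, of size Δ/2 each,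
are disjoint outside supp V. -/
theorem ThreeWeight.card_wordsOver_mul_le {Δ : ℕ} {C V : BinaryCode ι}
    (hC : ThreeWeight Δ C) (hVC : V ≤ C) (hV : 2 * #(codeSupport V) = 3 * Δ) :
    #(wordsOver Δ C V) * Δ + 3 * Δ ≤ 2 * #(codeSupport C) := by
  have hdisj : Set.PairwiseDisjoint (wordsOver Δ C V : Set (ι → ZMod 2))
      fun y => wordSupport y \ codeSupport V := by
    intro y hy z hz hyz
    have h1 := hC.le_hammingNorm (C.add_mem (mem_wordsOver.1 hy).1 (mem_wordsOver.1 hz).1)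
      (add_ne_zero_of_ne hyz)
    have h2 := hammingNorm_add y z
    rw [(mem_wordsOver.1 hy).2.1, (mem_wordsOver.1 hz).2.1] at h2
    have h3 := codeSupport_subset_inter hy hz
    have h4 := eq_of_subset_of_card_le h3 (by omega)
    simp only [Function.onFun]
    rw [disjoint_left]
    intro p hp hp'
    rw [mem_sdiff] at hp hp'
    exact hp.2 (h4 ▸ mem_inter.2 ⟨hp.1, hp'.1⟩)
  have hcard : ∀ y ∈ wordsOver Δ C V, 2 * #(wordSupport y \ codeSupport V) = Δ := by
    intro y hy
    have h1 := card_sdiff_add_card_eq_card (fun p hp => (mem_inter.1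
      (codeSupport_subset_inter hy hy hp)).1 : codeSupport V ⊆ wordSupport y)
    have h2 := (mem_wordsOver.1 hy).2.1
    rw [hammingNorm_eq_card] at h2
    omega
  have h5 : (wordsOver Δ C V).biUnion (fun y => wordSupport y \ codeSupport V)
      ⊆ codeSupport C \ codeSupport V := by
    refine biUnion_subset.2 fun y hy => sdiff_subset_sdiff
      (wordSupport_subset_codeSupport (mem_wordsOver.1 hy).1) le_rfl
  have h6 := card_le_card h5
  rw [card_biUnion hdisj] at h6
  have h7 : 2 * ∑ y ∈ wordsOver Δ C V, #(wordSupport y \ codeSupport V)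
      = #(wordsOver Δ C V) * Δ := by
    rw [mul_sum, sum_congr rfl hcard, sum_const, smul_eq_mul]
  have h8 := card_sdiff_add_card_eq_card (codeSupport_mono hVC)
  omega

theorem wordsOfWeight_eq_empty {Δ : ℕ} {C : BinaryCode ι} (h : #(codeSupport C) < Δ) :
    wordsOfWeight C Δ = ∅ := by
  refine eq_empty_of_forall_notMem fun c hc => ?_
  rw [mem_wordsOfWeight, hammingNorm_eq_card] at hc
  have := card_le_card (wordSupport_subset_codeSupport hc.1)
  omega

theorem constantWeight_span_singleton {Δ : ℕ} {x : ι → ZMod 2} (hx : hammingNorm x = Δ) :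
    ConstantWeight Δ (Submodule.span (ZMod 2) {x}) := by
  intro w hw hw0
  obtain ⟨b, rfl⟩ := Submodule.mem_span_singleton.1 hw
  by_cases hb : b = 0
  · exact absurd (by rw [hb, zero_smul]) hw0
  · rwa [eq_one_of_ne_zero hb, one_smul]

/-- If all constant weight subcodes have dimension at most two, the number of words of minimum
weight is bounded as for the replicated even weight code. -/
theorem ThreeWeight.card_wordsOfWeight_le_choose {Δ : ℕ} (hΔ : 0 < Δ) (t : ℕ) {C : BinaryCode ι}
    (hC : ThreeWeight Δ C) (hsmall : ∀ V ≤ C, ConstantWeight Δ V → #(words V) ≤ 4)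
    (hsupp : 2 * #(codeSupport C) ≤ t * Δ) :
    2 * #(wordsOfWeight C Δ) + t ≤ t * t := by
  -- The target is t(t - 1)/2, the number of pairs among t blocks of size Δ/2.
  induction t using Nat.strong_induction_on generalizing C with
  | _ t ih =>
  rcases (wordsOfWeight C Δ).eq_empty_or_nonempty with h0 | ⟨x, hx⟩
  · rw [h0, card_empty]
    nlinarith [Nat.le_mul_self t]
  rw [mem_wordsOfWeight] at hx
  obtain ⟨V, hV⟩ := exists_isMaxConstantWeight Δ C
  have hx0 : x ≠ 0 := fun h => by
    rw [h, hammingNorm_zero] at hx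
    omega
  have h2 : 1 < #(words V) :=
    (one_lt_card_words (Submodule.mem_span_singleton_self x) hx0).trans_le
      (hV.card_le _ ((Submodule.span_singleton_le_iff_mem _ _).2 hx.1)
        (constantWeight_span_singleton hx.2))
  have h4 := hsmall V hV.le hV.constantWeight
  have hu := hV.constantWeight.card_mul_card_codeSupport
  have haway := card_codeSupport_awayFrom hV.le
  have hCa := hC.mono (awayFrom_le C V)
  have hsa : ∀ W ≤ awayFrom C V, ConstantWeight Δ W → #(words W) ≤ 4 :=
    fun W hW => hsmall W (hW.trans (awayFrom_le C V))
  have hpow := card_words V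
  have hM : #(words V) = 2 ∨ #(words V) = 4 := by
    rcases hm : Module.finrank (ZMod 2) V with _ | _ | _ | m <;> rw [hm] at hpow
    · omega
    · left; simpa using hpow
    · right; simpa using hpow
    · have : 0 < 2 ^ m := by positivity
      rw [pow_add] at hpow
      omega
  rcases hM with hM | hM
  -- Here V occupies Δ positions, two blocks, and contributes one word.
  · rw [hM] at hu
    have hle := hC.card_wordsOfWeight_le_of_card_eq_two hΔ hV hM.le
    have ht : 2 ≤ t := by
      by_contra ht
      have : t * Δ ≤ 1 * Δ := Nat.mul_le_mul_right _ (by omega)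
      omega
    obtain ⟨s, rfl⟩ := Nat.exists_eq_add_of_le ht
    have := ih s (by omega) hCa hsa (by nlinarith)
    nlinarith
  -- Here V occupies 3Δ/2 positions, three blocks, and contributes at most 3(1 + s) words with s = t
  -- - 3; this is exactly the increment of t(t - 1)/2.
  · rw [hM] at hu
    have hu3 : 2 * #(codeSupport V) = 3 * Δ := by omega
    have hle := hC.card_wordsOfWeight_le hΔ hV
    have hY := hC.card_wordsOver_mul_le hV.le hu3
    have ht : 3 ≤ t := by
      by_contra ht
      have : t * Δ ≤ 2 * Δ := Nat.mul_le_mul_right _ (by omega)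
      omega
    obtain ⟨s, rfl⟩ := Nat.exists_eq_add_of_le ht
    have := ih s (by omega) hCa hsa (by nlinarith)
    have hYs : #(wordsOver Δ C V) ≤ s := by
      refine Nat.le_of_mul_le_mul_right ?_ hΔ
      nlinarith
    rw [hM] at hle
    nlinarith

theorem ConstantWeight.card_words_eq_or_le {Δ : ℕ} {V : BinaryCode ι} (hΔ : 0 < Δ)
    (hV : ConstantWeight Δ V) : #(words V) = 2 * Δ ∨ #(words V) ≤ Δ := by
  obtain ⟨k, hk⟩ := hV.card_words_dvd
  rcases k with _ | _ | k
  · omega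
  · left; omega
  · right; nlinarith [Nat.zero_le (#(words V) * k)]

/-- Bounds the contribution of one layer, with M = |V| and y the number of words over V; the
excluded case is the one giving a Reed–Muller subcode. -/
theorem pred_mul_le {M y Δ : ℕ} (hM : M = 2 * Δ ∨ M ≤ Δ) (hy : y ≤ 1)
    (h : ¬(M = 2 * Δ ∧ 0 < y)) :
    (M - 1) * (1 + y) ≤ 2 * Δ - 1 ∧ (M ≤ Δ → (M - 1) * (1 + y) ≤ 2 * Δ - 2) ∧
      (M ≤ Δ → 2 * Δ - 2 ≤ (M - 1) * (1 + y) → 2 ≤ Δ → M = Δ ∧ 0 < y) := by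
  interval_cases y <;> omega

theorem card_wordsOfWeight_ge_of_disjoint {Δ : ℕ} {C V W : BinaryCode ι} (hVC : V ≤ C)
    (hV : ConstantWeight Δ V) (hWC : W ≤ awayFrom C V) (hW : ConstantWeight Δ W) :
    (#(words V) - 1) + (#(words W) - 1) ≤ #(wordsOfWeight C Δ) := by
  rw [← card_erase_of_mem (zero_mem_words V), ← card_erase_of_mem (zero_mem_words W),
    ← card_union_of_disjoint]
  · refine card_le_card (union_subset ?_ ?_) <;> intro v hv <;>
      rw [mem_erase, mem_words] at hv <;> rw [mem_wordsOfWeight]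
    · exact ⟨hVC hv.2, hV v hv.2 hv.1⟩
    · exact ⟨(hWC hv.2).1, hW v hv.2 hv.1⟩
  · rw [disjoint_left]
    intro v hv hw
    rw [mem_erase, mem_words] at hv hw
    refine hv.1 (funext fun p => ?_)
    by_contra hp
    exact hp ((hWC hw.2).2 p (mem_codeSupport.2 ⟨v, hv.2, hp⟩))

/-- A code with weights `Δ`, `2Δ`, `3Δ`, length at most `4Δ` and at least `4Δ - 3` words of weight
`Δ` contains a first order Reed-Muller code of length `2Δ`, or it has at most `4Δ - 2` words of
weight `Δ` and, if their number is `4Δ - 3`, it contains the direct sum of a simplex code and a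
twofold replicated Reed-Muller code. -/
theorem ThreeWeight.exists_large_subcode {Δ : ℕ} (hΔ : 8 ≤ Δ) {C : BinaryCode ι}
    (hC : ThreeWeight Δ C) (hn : #(codeSupport C) ≤ 4 * Δ)
    (hN : 4 * Δ - 3 ≤ #(wordsOfWeight C Δ)) :
    (∃ V ≤ C, ConstantWeight Δ V ∧ #(words V) = 2 * Δ ∧ (wordsOver Δ C V).Nonempty) ∨
    (#(wordsOfWeight C Δ) ≤ 4 * Δ - 2 ∧ (#(wordsOfWeight C Δ) ≤ 4 * Δ - 3 →
      ∃ V ≤ C, ∃ W ≤ awayFrom C V, ConstantWeight Δ V ∧ ConstantWeight Δ W ∧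
        #(words V) = 2 * Δ ∧ #(words W) = Δ ∧ (wordsOver Δ (awayFrom C V) W).Nonempty)) := by
  have hpos : 0 < Δ := by omega
  by_cases hA : ∃ V ≤ C, ConstantWeight Δ V ∧ #(words V) = 2 * Δ ∧ (wordsOver Δ C V).Nonempty
  · exact Or.inl hA
  right
  obtain ⟨V, hV⟩ := exists_isMaxConstantWeight Δ C
  -- With t = 8 the small case allows at most 28 words, fewer than the 4Δ - 3 ≥ 29 present.
  have hM4 : 4 < #(words V) := by
    by_contra hle
    have := hC.card_wordsOfWeight_le_choose hpos 8
      (fun W hW hW' => (hV.card_le W hW hW').trans (not_lt.1 hle)) (by omega)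
    omega
  have hy1 := hC.card_wordsOver_le_one hpos hV.constantWeight hM4
  have hle1 := hC.card_wordsOfWeight_le hpos hV
  have hu1 := hV.constantWeight.card_mul_card_codeSupport
  have hs1 := card_codeSupport_awayFrom hV.le
  have hCa := hC.mono (awayFrom_le C V)
  have hd1 := hV.constantWeight.card_words_eq_or_le hpos
  have hn1 : ¬(#(words V) = 2 * Δ ∧ 0 < #(wordsOver Δ C V)) := fun h =>
    hA ⟨V, hV.le, hV.constantWeight, h.1, card_pos.1 h.2⟩
  have hb1 := pred_mul_le hd1 hy1 hn1
  have hu1' : 8 * Δ ≤ 5 * #(codeSupport V) := by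
    obtain ⟨m, hm⟩ := Nat.exists_eq_add_of_lt hM4
    rw [hm] at hu1
    simp only [Nat.add_sub_cancel] at hu1
    have : (4 + m + 1) * (8 * Δ) ≤ (4 + m + 1) * (5 * #(codeSupport V)) := by nlinarith
    exact Nat.le_of_mul_le_mul_left this (by omega)
  obtain ⟨W, hW⟩ := exists_isMaxConstantWeight Δ (awayFrom C V)
  -- At most 12Δ/5 positions remain, so t = 5 applies and allows at most 10 words, while at least 2Δ
  -- - 2 ≥ 14 are left after the first layer.
  have hM4' : 4 < #(words W) := by
    by_contra hle
    have := hCa.card_wordsOfWeight_le_choose hpos 5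
      (fun W' h h' => (hW.card_le W' h h').trans (not_lt.1 hle)) (by omega)
    omega
  have hy2 := hCa.card_wordsOver_le_one hpos hW.constantWeight hM4'
  have hle2 := hCa.card_wordsOfWeight_le hpos hW
  have hu2 := hW.constantWeight.card_mul_card_codeSupport
  have hs2 := card_codeSupport_awayFrom hW.le
  have hd2 := hW.constantWeight.card_words_eq_or_le hpos
  have hn2 : ¬(#(words W) = 2 * Δ ∧ 0 < #(wordsOver Δ (awayFrom C V) W)) := fun h => by
    obtain ⟨y, hy⟩ := card_pos.1 h.2
    rw [mem_wordsOver] at hy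
    exact hA ⟨W, hW.le.trans (awayFrom_le C V), hW.constantWeight, h.1,
      y, mem_wordsOver.2 ⟨hy.1.1, hy.2⟩⟩
  have hb2 := pred_mul_le hd2 hy2 hn2
  have hu2' : 8 * Δ ≤ 5 * #(codeSupport W) := by
    obtain ⟨m, hm⟩ := Nat.exists_eq_add_of_lt hM4'
    rw [hm] at hu2
    simp only [Nat.add_sub_cancel] at hu2
    have : (4 + m + 1) * (8 * Δ) ≤ (4 + m + 1) * (5 * #(codeSupport W)) := by nlinarith
    exact Nat.le_of_mul_le_mul_left this (by omega)
  -- Each layer uses at least 8Δ/5 positions, so fewer than Δ are left for a third one.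
  rw [wordsOfWeight_eq_empty (C := awayFrom (awayFrom C V) W) (by omega), card_empty] at hle2
  refine ⟨by omega, fun hN' => ?_⟩
  have hWV := hV.card_le W (hW.le.trans (awayFrom_le C V)) hW.constantWeight
  -- If V had at most Δ words, so would W by maximality, and both layers together would give at most
  -- 4Δ - 4.
  have hVcard : #(words V) = 2 * Δ := by
    rcases hd1 with h | h
    · exact h
    · have h1 := hb1.2.1 h
      have h2 := hb2.2.1 (hWV.trans h)
      omega
  have hge := card_wordsOfWeight_ge_of_disjoint hV.le hV.constantWeight hW.le hW.constantWeight
  -- If W also had 2Δ words, the nonzero words of V and W alone would number 4Δ - 2.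
  have hWle : #(words W) ≤ Δ := by omega
  obtain ⟨hWc, hy⟩ := hb2.2.2 hWle (by omega) (by omega)
  exact ⟨V, hV.le, W, hW.le, hV.constantWeight, hW.constantWeight, hVcard, hWc, card_pos.1 hy⟩

/-! ### Rigidity of constant weight codes with 2Δ words -/

/-- A constant weight code with the maximal number of words separates the positions of its support,
even together with one further position. -/
theorem ConstantWeight.separates {Δ : ℕ} {V : BinaryCode ι} (hV : ConstantWeight Δ V)
    (hΔ : 0 < Δ) (hM : #(words V) = 2 * Δ) {T : Finset ι} (hVT : codeSupport V ⊆ T)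
    (hT : #T = 2 * Δ ∨ #T + 1 = 2 * Δ) {p q : ι} (hp : p ∈ T) (hq : q ∈ T)
    (hpq : ∀ v ∈ V, v p = v q) : p = q := by
  have h := parseval V T 0
  simp only [Pi.zero_apply, zero_add, sgn_zero, mul_one] at h
  have hval : ∀ v ∈ (words V).erase 0, (∑ r ∈ T, sgn (v r)) ^ 2 = ((#T : ℤ) - 2 * Δ) ^ 2 := by
    intro v hv
    rw [mem_erase, mem_words] at hv
    rw [sum_sgn_eq_card, inter_eq_right.2 ((wordSupport_subset_codeSupport hv.2).trans hVT),
      ← hammingNorm_eq_card, hV v hv.2 hv.1]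
  rw [← sum_erase_add _ _ (zero_mem_words V), sum_congr rfl hval, sum_const,
    card_erase_of_mem (zero_mem_words V), hM] at h
  simp only [Pi.zero_apply, sgn_zero, sum_const, nsmul_eq_mul, mul_one] at h
  -- Nonzero words have character sum 0 or -1 on T, according to the size of T. In both cases
  -- Parseval yields exactly #T agreeing ordered pairs, which the diagonal already supplies.
  have hcount : ∑ r ∈ T, ∑ s ∈ T, (if ∀ v ∈ V, v r = v s then (1 : ℤ) else 0) = #T := by
    have hΔ' : (2 * Δ : ℤ) ≠ 0 := by positivity
    refine mul_left_cancel₀ hΔ' ?_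
    push_cast [Nat.cast_sub (show 1 ≤ 2 * Δ by omega)] at h
    rcases hT with hT | hT
    · rw [← h, hT]; push_cast; ring
    · have : (#T : ℤ) = 2 * Δ - 1 := by omega
      rw [← h, this]; ring
  by_contra hne
  have hle : ∀ r ∈ T, (1 : ℤ) ≤ ∑ s ∈ T, (if ∀ v ∈ V, v r = v s then (1 : ℤ) else 0) := by
    intro r hr
    have := single_le_sum (f := fun s => if ∀ v ∈ V, v r = v s then (1 : ℤ) else 0)
      (fun s _ => by positivity) hr
    simpa using this
  have hlt : (1 : ℤ) < ∑ s ∈ T, (if ∀ v ∈ V, v p = v s then (1 : ℤ) else 0) := by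
    rw [sum_boole]
    have : 1 < #{s ∈ T | ∀ v ∈ V, v p = v s} :=
      one_lt_card.2 ⟨p, by simp [hp], q, by simp only [mem_filter]; exact ⟨hq, hpq⟩, hne⟩
    exact_mod_cast this
  have := sum_lt_sum hle ⟨p, hp, hlt⟩
  rw [hcount] at this
  simp at this

/-- If all words of a coset of a maximal constant weight code of length `2Δ` have the same weight
modulo `Δ`, and this weight is a multiple of `Δ / 2`, then the coset consists of affine functions. -/
theorem ConstantWeight.affine_of_divisible {Δ : ℕ} {V : BinaryCode ι} (hV : ConstantWeight Δ V)
    (hΔ : 2 < Δ) (hM : #(words V) = 2 * Δ) {T : Finset ι} (hVT : codeSupport V ⊆ T)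
    (hT : #T = 2 * Δ) {f : ι → ZMod 2} {w : ℕ} (hw : Δ ∣ 2 * w)
    (hf : ∀ v ∈ V, Δ ∣ #(T ∩ wordSupport (f + v)) + w) :
    (∃ v ∈ V, ∀ p ∈ T, f p + v p = 0) ∨ (∃ v ∈ V, ∀ p ∈ T, f p + v p = 1) := by
  have h := parseval V T f
  have hrhs : ∑ p ∈ T, ∑ q ∈ T, (if ∀ v ∈ V, v p = v q then sgn (f p) * sgn (f q) else 0)
      = 2 * Δ := by
    have : ∀ p ∈ T, ∑ q ∈ T, (if ∀ v ∈ V, v p = v q then sgn (f p) * sgn (f q) else 0) = 1 := by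
      intro p hp
      rw [sum_eq_single p]
      · have : ∀ x : ZMod 2, sgn x * sgn x = 1 := by decide
        simp [this]
      · intro q hq hne
        rw [if_neg fun hpq => hne (hV.separates (by omega) hM hVT (Or.inl hT) hp hq hpq).symm]
      · exact fun hp' => absurd hp hp'
    rw [sum_congr rfl this]
    simp [hT]
  rw [hrhs, hM] at h
  have hsum : ∀ v, ∑ p ∈ T, sgn (f p + v p) = 2 * Δ - 2 * #(T ∩ wordSupport (f + v)) := by
    intro v
    have := sum_sgn_eq_card T (f + v)
    rw [hT] at this
    exact_mod_cast this
  -- The 2Δ coefficients have mean square 2Δ. If Δ divides w, each is 0 or ±2Δ, and one that is not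
  -- 0 makes the coset contain a word constant on T.
  by_cases hdvd : Δ ∣ w
  · have hex : ∃ v ∈ V, #(T ∩ wordSupport (f + v)) ≠ Δ := by
      by_contra hall
      push Not at hall
      rw [sum_congr rfl (g := fun _ => 0) (fun v hv => by
        rw [hsum, hall v (mem_words.1 hv)]; ring), sum_const_zero] at h
      have : (0 : ℤ) < Δ := by omega
      push_cast at h
      nlinarith
    obtain ⟨v, hv, hne⟩ := hex
    have hd : Δ ∣ #(T ∩ wordSupport (f + v)) := (Nat.dvd_add_left hdvd).1 (hf v hv)
    have hle : #(T ∩ wordSupport (f + v)) ≤ 2 * Δ := by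
      rw [← hT]; exact card_le_card inter_subset_left
    obtain ⟨k, hk⟩ := hd
    have hk2 : k ≤ 2 := by
      by_contra hlt
      have : Δ * 3 ≤ Δ * k := Nat.mul_le_mul_left _ (by omega)
      omega
    interval_cases k
    · left
      refine ⟨v, hv, fun p hp => ?_⟩
      rw [mul_zero, card_eq_zero, ← disjoint_iff_inter_eq_empty, disjoint_left] at hk
      simpa [mem_wordSupport] using hk hp
    · omega
    · right
      refine ⟨v, hv, fun p hp => ?_⟩
      have heq := eq_of_subset_of_card_le (inter_subset_left : T ∩ wordSupport (f + v) ⊆ T)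
        (by omega)
      rw [← heq, mem_inter, mem_wordSupport] at hp
      exact eq_one_of_ne_zero hp.2
  -- Otherwise every coefficient is a nonzero multiple of Δ, so the mean square is at least Δ² > 2Δ.
  · exfalso
    have hge : ∀ v ∈ words V, (Δ : ℤ) ^ 2 ≤ (∑ p ∈ T, sgn (f p + v p)) ^ 2 := by
      intro v hv
      rw [hsum]
      have h1 := hf v (mem_words.1 hv)
      have h2 : (Δ : ℤ) ∣ 2 * Δ - 2 * #(T ∩ wordSupport (f + v)) := by
        obtain ⟨s, hs⟩ := h1
        obtain ⟨t, ht⟩ := hw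
        refine ⟨2 - 2 * s + t, ?_⟩
        zify at hs ht
        linear_combination (-2 : ℤ) * hs + ht
      have hne : (2 * Δ - 2 * #(T ∩ wordSupport (f + v)) : ℤ) ≠ 0 := by
        intro h0
        have h3 : #(T ∩ wordSupport (f + v)) = Δ := by omega
        rw [h3] at h1
        exact hdvd ((Nat.dvd_add_right dvd_rfl).1 h1)
      have h3 := Int.le_of_dvd (abs_pos.2 hne) ((dvd_abs _ _).2 h2)
      rw [← sq_abs (2 * Δ - 2 * #(T ∩ wordSupport (f + v)) : ℤ)]
      exact pow_le_pow_left₀ (by positivity) h3 2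
    have h6 := card_nsmul_le_sum _ _ _ hge
    rw [h, hM, nsmul_eq_mul] at h6
    push_cast at h6
    have : (3 : ℤ) ≤ Δ := by omega
    nlinarith [mul_self_nonneg (Δ : ℤ), mul_pos (show (0:ℤ) < Δ by omega) (show (0:ℤ) < Δ by omega)]

/-! ### Power moments, repeated positions and the weight enumerator -/

theorem wordsOfWeight_zero (C : BinaryCode ι) : wordsOfWeight C 0 = {0} := by
  ext c
  rw [mem_wordsOfWeight, hammingNorm_eq_zero, mem_singleton]
  exact ⟨fun h => h.2, fun h => ⟨h ▸ C.zero_mem, h⟩⟩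

theorem ThreeWeight.sum_words {Δ : ℕ} (hΔ : 0 < Δ) {C : BinaryCode ι} (hC : ThreeWeight Δ C)
    (g : ℕ → ℤ) :
    ∑ c ∈ words C, g (hammingNorm c) = g 0 + #(wordsOfWeight C Δ) * g Δ
      + #(wordsOfWeight C (2 * Δ)) * g (2 * Δ) + #(wordsOfWeight C (3 * Δ)) * g (3 * Δ) := by
  have h1 : ∑ c ∈ words C, g (hammingNorm c)
      = ∑ w ∈ ({0, Δ, 2 * Δ, 3 * Δ} : Finset ℕ), ∑ c ∈ words C with hammingNorm c = w,
          g (hammingNorm c) := by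
    refine (sum_fiberwise_of_maps_to (fun c hc => ?_) _).symm
    rw [mem_words] at hc
    simp only [mem_insert, mem_singleton]
    by_cases h0 : c = 0
    · exact Or.inl (by rw [h0, hammingNorm_zero])
    · exact Or.inr (hC c hc h0)
  have h2 : ∀ w, ∑ c ∈ words C with hammingNorm c = w, g (hammingNorm c)
      = #(wordsOfWeight C w) * g w := by
    intro w
    have : (words C).filter (fun c => hammingNorm c = w) = wordsOfWeight C w := by
      ext c
      rw [mem_filter, mem_words, mem_wordsOfWeight]
    rw [this, sum_congr rfl (g := fun _ => g w)
      (fun c hc => by rw [(mem_wordsOfWeight.1 hc).2]), sum_const, nsmul_eq_mul]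
  rw [h1]
  simp only [h2]
  rw [sum_insert, sum_insert, sum_insert, sum_singleton, wordsOfWeight_zero]
  · simp; ring
  all_goals simp only [mem_insert, mem_singleton]; omega

/-- The number of ordered pairs of positions which agree in all codewords. -/
noncomputable def numEqualPairs (C : BinaryCode ι) : ℕ :=
  ∑ p : ι, #{q | ∀ c ∈ C, c p = c q}

theorem IsFullLength.codeSupport_eq {C : BinaryCode ι} (h : C.IsFullLength) :
    codeSupport C = univ := by
  ext p
  simpa [mem_codeSupport] using h p

/-- The first and second power moments of the weight distribution. -/
theorem ThreeWeight.power_moments {Δ : ℕ} (hΔ : 0 < Δ) {C : BinaryCode ι} (hC : ThreeWeight Δ C)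
    (hfull : C.IsFullLength) {n A₁ A₂ A₃ y N : ℤ} (hn : n = Fintype.card ι)
    (h₁ : A₁ = #(wordsOfWeight C Δ)) (h₂ : A₂ = #(wordsOfWeight C (2 * Δ)))
    (h₃ : A₃ = #(wordsOfWeight C (3 * Δ))) (hy : y = #(words C)) (hN : N = numEqualPairs C) :
    y = 1 + A₁ + A₂ + A₃ ∧
    n + A₁ * (n - 2 * Δ) + A₂ * (n - 4 * Δ) + A₃ * (n - 6 * Δ) = 0 ∧
    n ^ 2 + A₁ * (n - 2 * Δ) ^ 2 + A₂ * (n - 4 * Δ) ^ 2 + A₃ * (n - 6 * Δ) ^ 2 = y * N := by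
  have hsum : ∀ c : ι → ZMod 2, ∑ p, sgn (c p) = n - 2 * hammingNorm c := fun c => by
    rw [sum_sgn_eq_card, univ_inter, card_univ, hn, hammingNorm_eq_card]
  subst h₁ h₂ h₃
  refine ⟨?_, ?_, ?_⟩
  · have := hC.sum_words hΔ (fun _ => 1)
    simp only [sum_const, nsmul_eq_mul, mul_one] at this
    rw [hy, this]
  · have h := hC.sum_words hΔ (fun w => n - 2 * w)
    simp only [← hsum] at h
    rw [sum_comm, sum_congr rfl (g := fun _ => 0), sum_const_zero] at h
    · rw [h]; push_cast; ring
    · intro p _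
      refine (sum_sgn_linear C (LinearMap.proj p)).trans (if_neg ?_)
      obtain ⟨c, hc, hcp⟩ := hfull p
      exact fun h => hcp (h c hc)
  · have h := hC.sum_words hΔ (fun w => (n - 2 * w) ^ 2)
    have hp := parseval C univ 0
    simp only [Pi.zero_apply, zero_add, sgn_zero, mul_one, sum_boole] at hp
    simp only [← hsum] at h
    rw [hp] at h
    rw [hN, hy, numEqualPairs]
    push_cast at h ⊢
    rw [h]
    ring

theorem card_le_numEqualPairs (C : BinaryCode ι) : Fintype.card ι ≤ numEqualPairs C := by
  have : ∀ p ∈ (univ : Finset ι), 1 ≤ #{q | ∀ c ∈ C, c p = c q} :=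
    fun p _ => card_pos.2 ⟨p, by simp⟩
  simpa [numEqualPairs] using card_nsmul_le_sum _ _ _ this

theorem IsProjective.numEqualPairs_eq {C : BinaryCode ι} (h : C.IsProjective) :
    numEqualPairs C = Fintype.card ι := by
  have : ∀ p : ι, #{q | ∀ c ∈ C, c p = c q} = 1 := fun p =>
    card_eq_one.2 ⟨p, by
      ext q
      simp only [mem_filter, mem_univ, true_and, mem_singleton]
      exact ⟨fun hq => (h.2 p q hq).symm, fun hq => by simp [hq]⟩⟩
  simp [numEqualPairs, this]

/-- Two distinct equal positions add two ordered pairs to the n diagonal ones. -/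
theorem isProjective_of_numEqualPairs_le {C : BinaryCode ι} (hfull : C.IsFullLength)
    (h : numEqualPairs C ≤ Fintype.card ι + 1) : C.IsProjective := by
  refine ⟨hfull, fun p q hpq => ?_⟩
  by_contra hne
  have h1 : ∀ r : ι, 1 ≤ #{s | ∀ c ∈ C, c r = c s} := fun r => card_pos.2 ⟨r, by simp⟩
  have h2 : ∀ r s : ι, r ≠ s → (∀ c ∈ C, c r = c s) → 2 ≤ #{s | ∀ c ∈ C, c r = c s} :=
    fun r s hrs hall => one_lt_card.2 ⟨r, by simp, s, by simpa using hall, hrs⟩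
  have h3 : ∑ r : ι, (1 + (if r ∈ ({p, q} : Finset ι) then 1 else 0)) ≤ numEqualPairs C := by
    refine sum_le_sum fun r _ => ?_
    split_ifs with hr
    · rw [mem_insert, mem_singleton] at hr
      rcases hr with rfl | rfl
      · exact h2 r q hne hpq
      · exact h2 r p (Ne.symm hne) fun c hc => (hpq c hc).symm
    · exact h1 r
  rw [sum_add_distrib, sum_boole, filter_mem_eq_inter, univ_inter, card_pair hne] at h3
  simp at h3
  omega

theorem ThreeWeight.weightEnumerator_eq {Δ : ℕ} (hΔ : 0 < Δ) {C : BinaryCode ι}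
    (hC : ThreeWeight Δ C) (hn : 3 * Δ ≤ Fintype.card ι) :
    C.weightEnumerator = 1 + Polynomial.C (#(wordsOfWeight C Δ) : ℤ) * Polynomial.X ^ Δ
      + Polynomial.C (#(wordsOfWeight C (2 * Δ)) : ℤ) * Polynomial.X ^ (2 * Δ)
      + Polynomial.C (#(wordsOfWeight C (3 * Δ)) : ℤ) * Polynomial.X ^ (3 * Δ) := by
  have hcard : ∀ i, {c : ι → ZMod 2 | c ∈ C ∧ hammingNorm c = i}.ncard = #(wordsOfWeight C i) := by
    intro i
    rw [← Set.ncard_coe_finset]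
    congr 1
    ext c
    simp [mem_wordsOfWeight]
  rw [weightEnumerator]
  simp only [hcard]
  -- The assumption 3Δ ≤ n keeps all four exponents inside the range of summation.
  rw [← sum_subset (s₁ := ({0, Δ, 2 * Δ, 3 * Δ} : Finset ℕ))]
  · rw [sum_insert, sum_insert, sum_insert, sum_singleton, wordsOfWeight_zero]
    · simp only [card_singleton, Nat.cast_one, map_one,
        ← Polynomial.C_mul_X_pow_eq_monomial]
      ring
    all_goals simp only [mem_insert, mem_singleton]; omega
  · intro i hi
    simp only [mem_insert, mem_singleton] at hi
    rw [mem_range]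
    omega
  · intro i _ hi
    have : wordsOfWeight C i = ∅ := by
      refine eq_empty_of_forall_notMem fun c hc => hi ?_
      rw [mem_wordsOfWeight] at hc
      simp only [mem_insert, mem_singleton]
      rw [← hc.2]
      by_cases h0 : c = 0
      · exact Or.inl (by rw [h0, hammingNorm_zero])
      · exact Or.inr (hC c hc.1 h0)
    simp [this]

/-- The number of words of weight `Δ` in terms of the length `4Δ - s`. -/
theorem number_of_minimum_weight_words {Δ s A₁ A₂ A₃ y N : ℤ} (h₁ : y = 1 + A₁ + A₂ + A₃)
    (h₂ : 4 * Δ - s + A₁ * (4 * Δ - s - 2 * Δ) + A₂ * (4 * Δ - s - 4 * Δ)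
      + A₃ * (4 * Δ - s - 6 * Δ) = 0)
    (h₃ : (4 * Δ - s) ^ 2 + A₁ * (4 * Δ - s - 2 * Δ) ^ 2 + A₂ * (4 * Δ - s - 4 * Δ) ^ 2
      + A₃ * (4 * Δ - s - 6 * Δ) ^ 2 = y * N) :
    8 * Δ ^ 2 * A₁ = y * (s ^ 2 + 2 * Δ * s + N) - 24 * Δ ^ 2 ∧
      4 * Δ + 2 * Δ * (A₁ - A₃) = s * y := by
  subst h₁
  constructor
  -- In x = n - 2w this forms (x + s)(x + s + 2Δ), which vanishes at weights 2Δ and 3Δ and equals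
  -- 8Δ² at weight Δ and 24Δ² at weight 0.
  · linear_combination h₃ + (2 * Δ + 2 * s) * h₂
  · linear_combination h₂

/-! ### Splitting off a Reed–Muller code: length 4Δ - 1 -/

theorem ThreeWeight.dvd_hammingNorm {Δ : ℕ} {C : BinaryCode ι} (hC : ThreeWeight Δ C)
    {c : ι → ZMod 2} (hc : c ∈ C) : Δ ∣ hammingNorm c := by
  by_cases h0 : c = 0
  · rw [h0, hammingNorm_zero]; exact dvd_zero _
  · rcases hC c hc h0 with h | h | h <;> rw [h]
    · exact dvd_mul_left _ _
    · exact dvd_mul_left _ _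

/-- Adding a word of V does not change c outside T, so with w the weight of c there, the weights on
T along the coset satisfy one congruence modulo Δ. Comparing c with c + y gives Δ ∣ 2w, as
Parseval's argument requires. -/
theorem ThreeWeight.restrict_affine {Δ : ℕ} (hΔ : 2 < Δ) {C V : BinaryCode ι}
    (hC : ThreeWeight Δ C) (hVC : V ≤ C) (hV : ConstantWeight Δ V) (hM : #(words V) = 2 * Δ)
    {y : ι → ZMod 2} (hy : y ∈ C) (hyw : hammingNorm y = 2 * Δ) {T : Finset ι}
    (hT : #T = 2 * Δ) (hVT : codeSupport V ⊆ T) (hTy : T = wordSupport y ∨ T = (wordSupport y)ᶜ)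
    {c : ι → ZMod 2} (hc : c ∈ C) :
    (∃ v ∈ V, ∀ p ∈ T, c p + v p = 0) ∨ (∃ v ∈ V, ∀ p ∈ T, c p + v p = 1) := by
  have hsplit : ∀ d : ι → ZMod 2,
      #(T ∩ wordSupport d) + #(wordSupport d \ T) = hammingNorm d := fun d => by
    rw [hammingNorm_eq_card, inter_comm, card_inter_add_card_sdiff]
  refine hV.affine_of_divisible hΔ hM hVT hT (w := #(wordSupport c \ T)) ?_ fun v hv => ?_
  · have h1 := hammingNorm_add c y
    have h2 := hC.dvd_hammingNorm hc
    have h3 := hC.dvd_hammingNorm (C.add_mem hc hy)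
    have h4 := hsplit c
    rcases hTy with hTy | hTy
    · rw [← hTy, hyw, inter_comm] at h1
      have h5 : 2 * #(wordSupport c \ T) + 2 * Δ = hammingNorm c + hammingNorm (c + y) := by omega
      exact (Nat.dvd_add_left (dvd_mul_left Δ 2)).1 (h5 ▸ dvd_add h2 h3)
    · have h5 : wordSupport c \ T = wordSupport c ∩ wordSupport y := by
        rw [hTy, sdiff_compl]; rfl
      rw [← h5, hyw] at h1
      exact (Nat.dvd_add_right h3).1 (h1 ▸ dvd_add h2 (dvd_mul_left Δ 2))
  · have h1 : wordSupport c \ T = wordSupport (c + v) \ T := by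
      ext p
      simp only [mem_sdiff, mem_wordSupport, Pi.add_apply]
      refine and_congr_left fun hp => ?_
      have : v p = 0 := by
        by_contra h
        exact hp (hVT (mem_codeSupport.2 ⟨v, hv, h⟩))
      rw [this, add_zero]
    rw [h1, hsplit]
    exact hC.dvd_hammingNorm (C.add_mem hc (hVC hv))

theorem finrank_of_card_words {V : BinaryCode ι} {m : ℕ} (h : #(words V) = 2 ^ m) :
    Module.finrank (ZMod 2) V = m := by
  rw [card_words] at h
  exact Nat.pow_right_injective le_rfl h

theorem exists_spanning_family (V : BinaryCode ι) {m : ℕ} (h : Module.finrank (ZMod 2) V = m) :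
    ∃ u : Fin m → ι → ZMod 2, Submodule.span (ZMod 2) (Set.range u) = V := by
  let b := Module.finBasisOfFinrankEq (ZMod 2) V h
  refine ⟨fun i => b i, ?_⟩
  have := congrArg (Submodule.map V.subtype) b.span_eq
  rw [Submodule.map_span, ← Set.range_comp, Submodule.map_top, Submodule.range_subtype] at this
  exact this

omit [Fintype ι] in
theorem agree_of_span {m : ℕ} {u : Fin m → ι → ZMod 2} {V : BinaryCode ι}
    (hu : Submodule.span (ZMod 2) (Set.range u) = V) {p q : ι} (h : ∀ i, u i p = u i q)
    {v : ι → ZMod 2} (hv : v ∈ V) : v p = v q := by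
  rw [← hu, Submodule.mem_span_range_iff_exists_fun] at hv
  obtain ⟨x, rfl⟩ := hv
  simp [h]

theorem eq_zero_of_notMem_codeSupport {V : BinaryCode ι} {v : ι → ZMod 2} (hv : v ∈ V) {p : ι}
    (hp : p ∉ codeSupport V) : v p = 0 := by
  by_contra h
  exact hp (mem_codeSupport.2 ⟨v, hv, h⟩)

/-- Data of a decomposition of `C` into a first order Reed-Muller code, spanned by `V` and the
characteristic word `y` of its support, and the subcode of the words vanishing there. -/
theorem ThreeWeight.reedMuller_decomposition {Δ : ℕ} (hΔ : 2 < Δ) {C V : BinaryCode ι}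
    (hC : ThreeWeight Δ C) (hVC : V ≤ C) (hV : ConstantWeight Δ V) (hM : #(words V) = 2 * Δ)
    {y : ι → ZMod 2} (hy : y ∈ wordsOver Δ C V) :
    ConstantWeight Δ (C ⊓ vanishingOn (wordSupport y)) ∧
      ∀ c ∈ C, ∃ v ∈ V, ∃ b : ZMod 2, ∃ k ∈ C ⊓ vanishingOn (wordSupport y), c = v + b • y + k := by
  rw [mem_wordsOver] at hy
  obtain ⟨hyC, hyw, hyV⟩ := hy
  have hVT : codeSupport V ⊆ wordSupport y := fun p hp => by
    rw [mem_wordSupport, hyV p hp]; decide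
  constructor
  -- k is disjoint from y, so y + k has weight 2Δ + wt k ≤ 3Δ, leaving only wt k = Δ.
  · intro k hk hk0
    have h1 := hammingNorm_add y k
    rw [card_inter_eq_zero_iff.2 hk.2, hyw] at h1
    have h2 : y + k ≠ 0 := fun h => by
      rw [h, hammingNorm_zero] at h1; omega
    have h3 := hC k hk.1 hk0
    rcases hC _ (C.add_mem hyC hk.1) h2 with h | h | h <;> omega
  · intro c hc
    rcases hC.restrict_affine hΔ hVC hV hM hyC hyw hyw hVT (Or.inl rfl) hc with
      ⟨v, hv, h⟩ | ⟨v, hv, h⟩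
    · refine ⟨v, hv, 0, c + v, ⟨C.add_mem hc (hVC hv), h⟩, ?_⟩
      rw [zero_smul, add_zero, add_comm c v, ← add_assoc, add_self, zero_add]
    · refine ⟨v, hv, 1, c + v + y, ⟨C.add_mem (C.add_mem hc (hVC hv)) hyC, fun p hp => ?_⟩, ?_⟩
      · rw [Pi.add_apply, Pi.add_apply, h p hp,
          eq_one_of_ne_zero (mem_wordSupport.1 hp)]
        rfl
      · rw [one_smul]
        have : v + y + (c + v + y) = c + (v + v) + (y + y) := by abel
        rw [this, add_self, add_self, add_zero, add_zero]

/-- C is spanned by V, y and the words K vanishing on supp y, of dimensions a+1, 1 and at most a+1.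
Equality makes K a constant weight code with 2Δ words, hence with 2Δ - 1 support positions, and full
length identifies these with the complement of supp y. -/
theorem ThreeWeight.finrank_le_of_reedMuller {a Δ : ℕ} (hΔ : Δ = 2 ^ a) (hΔ2 : 2 < Δ)
    {C V : BinaryCode ι} (hC : ThreeWeight Δ C) (hfull : C.IsFullLength) (hVC : V ≤ C)
    (hV : ConstantWeight Δ V) (hM : #(words V) = 2 * Δ) {y : ι → ZMod 2}
    (hy : y ∈ wordsOver Δ C V) :
    Module.finrank (ZMod 2) C ≤ 2 * a + 3 ∧ (Module.finrank (ZMod 2) C = 2 * a + 3 →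
      #(words (C ⊓ vanishingOn (wordSupport y))) = 2 * Δ ∧ Fintype.card ι + 1 = 4 * Δ ∧
      codeSupport (C ⊓ vanishingOn (wordSupport y)) = (wordSupport y)ᶜ ∧ C.IsProjective) := by
  obtain ⟨hK, hdec⟩ := hC.reedMuller_decomposition hΔ2 hVC hV hM hy
  rw [mem_wordsOver] at hy
  obtain ⟨hyC, hyw, hyV⟩ := hy
  have hVT : codeSupport V ⊆ wordSupport y := fun p hp => by
    rw [mem_wordSupport, hyV p hp]; decide
  set K := C ⊓ vanishingOn (wordSupport y) with hKdef
  have hVfin : Module.finrank (ZMod 2) V = a + 1 :=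
    finrank_of_card_words (by rw [hM, hΔ, pow_succ]; ring)
  have hKle : Module.finrank (ZMod 2) K ≤ a + 1 := by
    have h1 := Nat.le_of_dvd (by omega) hK.card_words_dvd
    rw [card_words, hΔ, ← pow_succ'] at h1
    exact (Nat.pow_le_pow_iff_right (by norm_num)).1 h1
  have hCle : Module.finrank (ZMod 2) C ≤ (a + 1) + 1 + Module.finrank (ZMod 2) K := by
    have h1 : C ≤ V ⊔ Submodule.span (ZMod 2) {y} ⊔ K := by
      intro c hc
      obtain ⟨v, hv, b, k, hk, rfl⟩ := hdec c hc
      exact Submodule.add_mem_sup (Submodule.add_mem_sup hv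
        (Submodule.smul_mem _ _ (Submodule.mem_span_singleton_self y))) hk
    have h2 := Submodule.finrank_mono h1
    have h3 := Submodule.finrank_add_le_finrank_add_finrank
      (V ⊔ Submodule.span (ZMod 2) {y}) K
    have h4 := Submodule.finrank_add_le_finrank_add_finrank V (Submodule.span (ZMod 2) {y})
    have hy0 : y ≠ 0 := fun h => by
      rw [h, hammingNorm_zero] at hyw; omega
    rw [finrank_span_singleton hy0, hVfin] at h4
    omega
  refine ⟨by omega, fun hdim => ?_⟩
  have hKcard : #(words K) = 2 * Δ := by
    rw [card_words, hΔ, ← pow_succ', show Module.finrank (ZMod 2) K = a + 1 by omega]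
  have hKsupp : codeSupport K = (wordSupport y)ᶜ := by
    ext p
    rw [mem_compl]
    constructor
    · intro hp hpy
      obtain ⟨k, hk, hkp⟩ := mem_codeSupport.1 hp
      exact hkp (hk.2 p hpy)
    · intro hp
      obtain ⟨c, hc, hcp⟩ := hfull p
      obtain ⟨v, hv, b, k, hk, rfl⟩ := hdec c hc
      refine mem_codeSupport.2 ⟨k, hk, ?_⟩
      have h1 : v p = 0 := eq_zero_of_notMem_codeSupport hv fun h => hp (hVT h)
      have h2 : y p = 0 := by simpa [mem_wordSupport] using hp
      simpa [h1, h2] using hcp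
  have hlen : #(codeSupport K) + 1 = 2 * Δ := by
    have h1 := hK.card_mul_card_codeSupport
    rw [hKcard] at h1
    have h2 : 2 * Δ * #(codeSupport K) = 2 * Δ * (2 * Δ - 1) := by rw [h1]; ring
    have := Nat.eq_of_mul_eq_mul_left (by omega) h2
    omega
  refine ⟨hKcard, ?_, hKsupp, hfull, fun p q hpq => ?_⟩
  · have h1 := card_add_card_compl (wordSupport y)
    rw [← hKsupp, ← hammingNorm_eq_card, hyw] at h1
    omega
  · by_cases hp : p ∈ wordSupport y
    · have hq : q ∈ wordSupport y := by
        rwa [mem_wordSupport, ← hpq y hyC, ← mem_wordSupport]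
      exact hV.separates (by omega) hM hVT (Or.inl hyw) hp hq fun v hv => hpq v (hVC hv)
    · have hq : q ∉ wordSupport y := by
        rwa [mem_wordSupport, ← hpq y hyC, ← mem_wordSupport]
      rw [← mem_compl, ← hKsupp] at hp hq
      exact hK.separates (by omega) hKcard Subset.rfl (Or.inr hlen) hp hq
        fun v hv => hpq v hv.1

/-- A code splitting into a Reed-Muller code and a simplex code. -/
theorem ThreeWeight.isomorphic_directSum {a Δ : ℕ} (hΔ : Δ = 2 ^ a) (hΔ2 : 2 < Δ)
    {C V : BinaryCode ι} (hC : ThreeWeight Δ C) (hfull : C.IsFullLength) (hVC : V ≤ C)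
    (hV : ConstantWeight Δ V) (hM : #(words V) = 2 * Δ) {y : ι → ZMod 2}
    (hy : y ∈ wordsOver Δ C V) (hdim : Module.finrank (ZMod 2) C = 2 * a + 3) :
    C.Isomorphic (directSum (simplexCode (a + 1)) (reedMullerCode (a + 1))) := by
  obtain ⟨-, hdec⟩ := hC.reedMuller_decomposition hΔ2 hVC hV hM hy
  obtain ⟨hKcard, hn, hKsupp, -, hsep⟩ :=
    (hC.finrank_le_of_reedMuller hΔ hΔ2 hfull hVC hV hM hy).2 hdim
  rw [mem_wordsOver] at hy
  obtain ⟨hyC, hyw, hyV⟩ := hy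
  have hVT : codeSupport V ⊆ wordSupport y := fun p hp => by
    rw [mem_wordSupport, hyV p hp]; decide
  set K := C ⊓ vanishingOn (wordSupport y) with hKdef
  obtain ⟨u, hu⟩ := exists_spanning_family V
    (finrank_of_card_words (m := a + 1) (by rw [hM, hΔ, pow_succ]; ring))
  obtain ⟨w, hw⟩ := exists_spanning_family K
    (finrank_of_card_words (m := a + 1) (by rw [hKcard, hΔ, pow_succ]; ring))
  have huV : ∀ i, u i ∈ V := fun i => hu ▸ Submodule.subset_span ⟨i, rfl⟩
  have hwK : ∀ i, w i ∈ K := fun i => hw ▸ Submodule.subset_span ⟨i, rfl⟩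
  have hne : ∀ p, p ∉ wordSupport y → (fun i => w i p) ≠ 0 := by
    intro p hp h0
    rw [← mem_compl, ← hKsupp] at hp
    obtain ⟨k, hk, hkp⟩ := mem_codeSupport.1 hp
    rw [← hw, Submodule.mem_span_range_iff_exists_fun] at hk
    obtain ⟨x, rfl⟩ := hk
    have h1 : ∀ i, w i p = 0 := fun i => congrFun h0 i
    exact hkp (by simp [h1])
  -- Each position is sent to its column in the spanning family of V on supp y and of K off it.
  -- Projectivity makes this injective, and counting makes it bijective.
  let Φ : ι → {v : Fin (a + 1) → ZMod 2 // v ≠ 0} ⊕ (Fin (a + 1) → ZMod 2) := fun p =>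
    if hp : p ∈ wordSupport y then Sum.inr fun i => u i p else Sum.inl ⟨fun i => w i p, hne p hp⟩
  have hΦin : ∀ p, p ∈ wordSupport y → Φ p = Sum.inr fun i => u i p := fun p hp => dif_pos hp
  have hΦout : ∀ p (hp : p ∉ wordSupport y), Φ p = Sum.inl ⟨fun i => w i p, hne p hp⟩ :=
    fun p hp => dif_neg hp
  have hinj : Function.Injective Φ := by
    intro p q hpq
    refine hsep p q fun c hc => ?_
    obtain ⟨v, hv, b, k, hk, rfl⟩ := hdec c hc
    by_cases hp : p ∈ wordSupport y <;> by_cases hq : q ∈ wordSupport y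
    · rw [hΦin p hp, hΦin q hq, Sum.inr.injEq] at hpq
      have h1 := agree_of_span hu (fun i => congrFun hpq i) hv
      simp [h1, hk.2 p hp, hk.2 q hq, eq_one_of_ne_zero (mem_wordSupport.1 hp),
        eq_one_of_ne_zero (mem_wordSupport.1 hq)]
    · rw [hΦin p hp, hΦout q hq] at hpq
      exact absurd hpq (by simp)
    · rw [hΦout p hp, hΦin q hq] at hpq
      exact absurd hpq (by simp)
    · rw [hΦout p hp, hΦout q hq, Sum.inl.injEq, Subtype.mk.injEq] at hpq
      have h1 := agree_of_span hw (fun i => congrFun hpq i) hk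
      have hp' : y p = 0 := by simpa [mem_wordSupport] using hp
      have hq' : y q = 0 := by simpa [mem_wordSupport] using hq
      simp [h1, hp', hq', eq_zero_of_notMem_codeSupport hv fun h => hp (hVT h),
        eq_zero_of_notMem_codeSupport hv fun h => hq (hVT h)]
  have hbij : Function.Bijective Φ := by
    refine (Fintype.bijective_iff_injective_and_card Φ).2 ⟨hinj, ?_⟩
    have h1 : Fintype.card {v : Fin (a + 1) → ZMod 2 // v ≠ 0} = 2 ^ (a + 1) - 1 := by
      rw [Fintype.card_subtype_compl, Fintype.card_subtype_eq]
      simp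
    rw [Fintype.card_sum, h1]
    simp only [Fintype.card_pi, ZMod.card, prod_const, card_univ, Fintype.card_fin]
    rw [pow_succ, ← hΔ]
    omega
  have hval : ∀ (x x' : Fin (a + 1) → ZMod 2) (b : ZMod 2),
      (Sum.elim (fun v => x ⬝ᵥ v.1) (fun v => x' ⬝ᵥ v + b)) ∘ Φ
        = ∑ i, x' i • u i + b • y + ∑ i, x i • w i := by
    intro x x' b
    funext p
    by_cases hp : p ∈ wordSupport y
    · have h1 : ∀ i, w i p = 0 := fun i => (hwK i).2 p hp
      simp [hΦin p hp, dotProduct, h1, eq_one_of_ne_zero (mem_wordSupport.1 hp)]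
    · have h1 : ∀ i, u i p = 0 :=
        fun i => eq_zero_of_notMem_codeSupport (huV i) fun h => hp (hVT h)
      have hp' : y p = 0 := by simpa [mem_wordSupport] using hp
      simp [hΦout p hp, dotProduct, h1, hp']
  refine ⟨Equiv.ofBijective Φ hbij, fun c => ?_⟩
  change c ∈ _ ↔ c ∘ Φ ∈ C
  constructor
  · rintro ⟨⟨x, hx⟩, x', b, hx'⟩
    have hc : c = Sum.elim (fun v => x ⬝ᵥ v.1) (fun v => x' ⬝ᵥ v + b) := by
      funext p
      rcases p with p | p
      · exact hx p
      · exact hx' p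
    rw [hc, hval]
    exact C.add_mem (C.add_mem (C.sum_mem fun i _ => C.smul_mem _ (hVC (huV i)))
      (C.smul_mem _ hyC)) (C.sum_mem fun i _ => C.smul_mem _ (hwK i).1)
  · intro hc
    obtain ⟨v, hv, b, k, hk, hcv⟩ := hdec _ hc
    rw [← hu, Submodule.mem_span_range_iff_exists_fun] at hv
    rw [← hw, Submodule.mem_span_range_iff_exists_fun] at hk
    obtain ⟨x', rfl⟩ := hv
    obtain ⟨x, rfl⟩ := hk
    rw [← hval] at hcv
    have := hbij.2.injective_comp_right hcv
    rw [this]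
    exact ⟨⟨x, fun _ => rfl⟩, x', b, fun _ => rfl⟩

/-! ### Two Reed–Muller blocks sharing a row: length 4Δ -/

theorem finrank_directSum {ι κ : Type*} [Finite ι] [Finite κ] (C : BinaryCode ι)
    (D : BinaryCode κ) : Module.finrank (ZMod 2) (directSum C D)
      = Module.finrank (ZMod 2) C + Module.finrank (ZMod 2) D := by
  rw [← Module.finrank_prod]
  exact LinearEquiv.finrank_eq
    { toFun := fun c => (⟨c.1 ∘ Sum.inl, c.2.1⟩, ⟨c.1 ∘ Sum.inr, c.2.2⟩)
      invFun := fun p => ⟨Sum.elim p.1.1 p.2.1, by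
        exact ⟨by simp, by simp⟩⟩
      map_add' := fun _ _ => rfl
      map_smul' := fun _ _ => rfl
      left_inv := fun c => Subtype.ext (Sum.elim_comp_inl_inr c.1)
      right_inv := fun _ => rfl }

theorem finrank_reedMullerCode (m : ℕ) : Module.finrank (ZMod 2) (reedMullerCode m) = m + 1 := by
  obtain ⟨h1, h2⟩ := isGeneratorMatrix_coordinates m
  rw [← h2, finrank_span_eq_card h1]
  simp

/-- Equal columns of R would make all affine functions agree at two points, yet the coordinate
functions separate points. -/
theorem bijective_columns_of_isGeneratorMatrix {m : ℕ}
    {R : Matrix (Fin m) (Fin m → ZMod 2) (ZMod 2)}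
    (hR : IsGeneratorMatrix (appendOnes R) (reedMullerCode m)) :
    Function.Bijective fun (v : Fin m → ZMod 2) i => R i v := by
  refine Finite.injective_iff_bijective.1 fun v v' hv => ?_
  have hall : ∀ c ∈ reedMullerCode m, c v = c v' := by
    intro c hc
    rw [← hR.2, Submodule.mem_span_range_iff_exists_fun] at hc
    obtain ⟨x, rfl⟩ := hc
    have h1 : ∀ i, R i v = R i v' := fun i => congrFun hv i
    simp [appendOnes, Matrix.row, h1]
  funext i
  exact hall (fun v => v i) ⟨Pi.single i 1, 0, fun v => by simp⟩

/-- The structure of a code containing the direct sum of a simplex code and a twofold replicated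
Reed-Muller code with a codimension of one. -/
theorem ThreeWeight.overlap_decomposition {a Δ : ℕ} (hΔ : Δ = 2 ^ a) (hΔ2 : 2 < Δ)
    {C V W : BinaryCode ι} (hC : ThreeWeight Δ C) (hfull : C.IsFullLength)
    (hn : Fintype.card ι = 4 * Δ) (hdim : Module.finrank (ZMod 2) C = 2 * a + 3)
    (hVC : V ≤ C) (hWC : W ≤ awayFrom C V) (hV : ConstantWeight Δ V) (hW : ConstantWeight Δ W)
    (hM : #(words V) = 2 * Δ) (hM' : #(words W) = Δ) {y : ι → ZMod 2}
    (hy : y ∈ wordsOver Δ (awayFrom C V) W) :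
    ∃ q ∈ C, (∀ p, p ∉ wordSupport y → q p = 1) ∧
      ∀ c ∈ C, ∃ v ∈ V, ∃ b : ZMod 2, ∃ w ∈ W, ∃ d : ZMod 2, c = v + b • q + w + d • y := by
  rw [mem_wordsOver] at hy
  obtain ⟨⟨hyC, hyV⟩, hyw, hyW⟩ := hy
  set T := (wordSupport y)ᶜ with hTdef
  have hT : #T = 2 * Δ := by
    rw [hTdef, card_compl, ← hammingNorm_eq_card, hyw, hn]
    omega
  have hVT : codeSupport V ⊆ T := fun p hp => by
    rw [hTdef, mem_compl, mem_wordSupport, not_not]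
    exact hyV p hp
  have hWT : ∀ w ∈ W, ∀ p ∈ T, w p = 0 := by
    intro w hw p hp
    refine eq_zero_of_notMem_codeSupport hw fun h => ?_
    rw [hTdef, mem_compl, mem_wordSupport, not_not, hyW p h] at hp
    exact one_ne_zero hp
  have hyT : ∀ p ∈ T, y p = 0 := fun p hp => by
    rwa [hTdef, mem_compl, mem_wordSupport, not_not] at hp
  have hVcard : #(codeSupport V) + 1 = 2 * Δ := by
    have h1 := hV.card_mul_card_codeSupport
    rw [hM] at h1
    have h2 : 2 * Δ * #(codeSupport V) = 2 * Δ * (2 * Δ - 1) := by rw [h1]; ring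
    have := Nat.eq_of_mul_eq_mul_left (by omega) h2
    omega
  -- V has 2Δ - 1 support positions, so p₀ is the one further position of T; it plays the role of
  -- the origin of the affine space T.
  obtain ⟨p₀, hp₀, hp₀V⟩ := exists_mem_notMem_of_card_lt_card
    (show #(codeSupport V) < #T by omega)
  have hVp₀ : ∀ v ∈ V, v p₀ = 0 := fun v hv => eq_zero_of_notMem_codeSupport hv hp₀V
  have haff := fun c hc => hC.restrict_affine hΔ2 hVC hV hM hyC hyw hT hVT (Or.inr rfl) (c := c) hc
  -- A word nonzero at p₀ cannot agree on T with a word of V, so it differs from one by the constant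
  -- 1 there.
  obtain ⟨q, hq, hq1⟩ : ∃ q ∈ C, ∀ p ∈ T, q p = 1 := by
    obtain ⟨c, hc, hcp⟩ := hfull p₀
    rcases haff c hc with ⟨v, hv, h⟩ | ⟨v, hv, h⟩
    · have := h p₀ hp₀
      rw [hVp₀ v hv, add_zero] at this
      exact absurd this hcp
    · exact ⟨c + v, C.add_mem hc (hVC hv), h⟩
  refine ⟨q, hq, fun p hp => hq1 p (mem_compl.2 hp), ?_⟩
  set K := C ⊓ vanishingOn T with hK
  have hVfin : Module.finrank (ZMod 2) V = a + 1 :=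
    finrank_of_card_words (by rw [hM, hΔ, pow_succ]; ring)
  have hWfin : Module.finrank (ZMod 2) W = a := finrank_of_card_words (by rw [hM', hΔ])
  have hKle : Module.finrank (ZMod 2) K ≤ a + 1 := by
    have hinf : V ⊓ K = ⊥ := by
      refine (Submodule.eq_bot_iff _).2 fun v hv => funext fun p => ?_
      by_cases hp : p ∈ T
      · exact hv.2.2 p hp
      · exact eq_zero_of_notMem_codeSupport hv.1 fun h => hp (hVT h)
    -- All words of V and of K vanish at p₀, but q does not; this strictness gives dim K ≤ a+1.
    have hlt : V ⊔ K < C := by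
      refine lt_of_le_of_ne (sup_le hVC inf_le_left) fun h => ?_
      rw [← h] at hq
      obtain ⟨v, hv, k, hk, hvk⟩ := Submodule.mem_sup.1 hq
      have h1 := hq1 p₀ hp₀
      rw [← hvk, Pi.add_apply, hVp₀ v hv, hk.2 p₀ hp₀, add_zero] at h1
      exact zero_ne_one h1
    have h1 := Submodule.finrank_sup_add_finrank_inf_eq V K
    have h2 := Submodule.finrank_lt_finrank_of_lt hlt
    rw [hinf, finrank_bot] at h1
    omega
  have hKeq : W ⊔ Submodule.span (ZMod 2) {y} = K := by
    refine Submodule.eq_of_le_of_finrank_le (sup_le (fun w hw => ⟨(hWC hw).1, hWT w hw⟩)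
      ((Submodule.span_singleton_le_iff_mem _ _).2 ⟨hyC, hyT⟩)) (hKle.trans ?_)
    have hlt : W < W ⊔ Submodule.span (ZMod 2) {y} := by
      refine lt_of_le_of_ne le_sup_left fun h => ?_
      have hyW' : y ∈ W := h ▸ Submodule.mem_sup_right (Submodule.mem_span_singleton_self y)
      have hy0 : y ≠ 0 := fun h => by
        rw [h, hammingNorm_zero] at hyw; omega
      have := hW y hyW' hy0
      omega
    have := Submodule.finrank_lt_finrank_of_lt hlt
    omega
  have hKmem : ∀ k ∈ K, ∃ w ∈ W, ∃ d : ZMod 2, k = w + d • y := by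
    intro k hk
    rw [← hKeq] at hk
    obtain ⟨w, hw, z, hz, rfl⟩ := Submodule.mem_sup.1 hk
    obtain ⟨d, rfl⟩ := Submodule.mem_span_singleton.1 hz
    exact ⟨w, hw, d, rfl⟩
  intro c hc
  rcases haff c hc with ⟨v, hv, h⟩ | ⟨v, hv, h⟩
  · obtain ⟨w, hw, d, hk⟩ := hKmem (c + v) ⟨C.add_mem hc (hVC hv), h⟩
    refine ⟨v, hv, 0, w, hw, d, ?_⟩
    rw [zero_smul, add_zero, add_assoc, ← hk, add_comm c v, ← add_assoc, add_self, zero_add]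
  · obtain ⟨w, hw, d, hk⟩ := hKmem (c + v + q) ⟨C.add_mem (C.add_mem hc (hVC hv)) hq,
      fun p hp => by
        rw [Pi.add_apply, Pi.add_apply, h p hp, hq1 p hp]
        rfl⟩
    refine ⟨v, hv, 1, w, hw, d, ?_⟩
    have : v + q + (c + v + q) = c + (v + v) + (q + q) := by abel
    rw [one_smul, add_assoc, ← hk, this, add_self, add_self, add_zero, add_zero]

/-- The code generated by the overlap matrix has the required properties, if its rows pull back
to generators of a code of full dimension. -/
theorem exists_overlap_code {a Δ : ℕ} (hΔ : Δ = 2 ^ a) (hΔ2 : 2 < Δ)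
    {C V W : BinaryCode ι} (hC : ThreeWeight Δ C) (hproj : C.IsProjective)
    (hn : Fintype.card ι = 4 * Δ) (hdim : Module.finrank (ZMod 2) C = 2 * a + 3)
    (hVC : V ≤ C) (hWC : W ≤ awayFrom C V) (hV : ConstantWeight Δ V) (hW : ConstantWeight Δ W)
    (hM : #(words V) = 2 * Δ) (hM' : #(words W) = Δ) {y : ι → ZMod 2}
    (hy : y ∈ wordsOver Δ (awayFrom C V) W)
    {R : Matrix (Fin (a + 1)) (Fin (a + 1) → ZMod 2) (ZMod 2)}
    (hR : IsGeneratorMatrix (appendOnes R) (reedMullerCode (a + 1))) :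
    ∃ D : BinaryCode ((Fin (a + 1) → ZMod 2) ⊕ (Fin (a + 1) → ZMod 2)),
      IsGeneratorMatrix (overlapMatrix R) D ∧
      D ≤ directSum (reedMullerCode (a + 1)) (reedMullerCode (a + 1)) ∧
      Module.finrank (ZMod 2) (directSum (reedMullerCode (a + 1)) (reedMullerCode (a + 1)))
        = Module.finrank (ZMod 2) D + 1 ∧
      C.Isomorphic D := by
  obtain ⟨q, hq, hq1, hdec⟩ := hC.overlap_decomposition hΔ hΔ2 hproj.1 hn hdim hVC hWC hV hW
    hM hM' hy
  rw [mem_wordsOver] at hy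
  obtain ⟨⟨hyC, hyV⟩, hyw, hyW⟩ := hy
  obtain ⟨u, hu⟩ := exists_spanning_family V
    (finrank_of_card_words (m := a + 1) (by rw [hM, hΔ, pow_succ]; ring))
  obtain ⟨w, hw⟩ := exists_spanning_family W (finrank_of_card_words (m := a) (by rw [hM', hΔ]))
  have huV : ∀ i, u i ∈ V := fun i => hu ▸ Submodule.subset_span ⟨i, rfl⟩
  have hwW : ∀ i, w i ∈ W := fun i => hw ▸ Submodule.subset_span ⟨i, rfl⟩
  have hu0 : ∀ p ∈ wordSupport y, ∀ v ∈ V, v p = 0 := fun p hp v hv =>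
    eq_zero_of_notMem_codeSupport hv fun h => mem_wordSupport.1 hp (hyV p h)
  have hw0 : ∀ p, p ∉ wordSupport y → ∀ v ∈ W, v p = 0 := fun p hp v hv =>
    eq_zero_of_notMem_codeSupport hv fun h => hp (mem_wordSupport.2 (by
      rw [hyW p h]; exact one_ne_zero))
  have hy0 : ∀ p, p ∉ wordSupport y → y p = 0 := fun p hp => by simpa [mem_wordSupport] using hp
  have hy1 : ∀ p ∈ wordSupport y, y p = 1 := fun p hp => eq_one_of_ne_zero (mem_wordSupport.1 hp)
  let ρ := Equiv.ofBijective _ (bijective_columns_of_isGeneratorMatrix hR)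
  have hρ : ∀ x i, R i (ρ.symm x) = x i := fun x i => congrFun (ρ.apply_symm_apply x) i
  -- q is the shared row: it is one off supp y, and its part on supp y serves as the first row of
  -- the right block.
  let z : Fin (a + 1) → ι → ZMod 2 := Fin.cons q w
  let Φ : ι → (Fin (a + 1) → ZMod 2) ⊕ (Fin (a + 1) → ZMod 2) := fun p =>
    if p ∈ wordSupport y then Sum.inr (ρ.symm fun i => z i p) else Sum.inl (ρ.symm fun i => u i p)
  have hΦin : ∀ p, p ∈ wordSupport y → Φ p = Sum.inr (ρ.symm fun i => z i p) :=
    fun p hp => if_pos hp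
  have hΦout : ∀ p, p ∉ wordSupport y → Φ p = Sum.inl (ρ.symm fun i => u i p) :=
    fun p hp => if_neg hp
  have hinj : Function.Injective Φ := by
    intro p p' hpp
    refine hproj.2 p p' fun c hc => ?_
    obtain ⟨v, hv, b, x, hx, d, rfl⟩ := hdec c hc
    by_cases hp : p ∈ wordSupport y <;> by_cases hp' : p' ∈ wordSupport y
    · rw [hΦin p hp, hΦin p' hp', Sum.inr.injEq, ρ.symm.injective.eq_iff] at hpp
      have h1 : q p = q p' := congrFun hpp 0
      have h2 := agree_of_span hw (fun i => congrFun hpp i.succ) hx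
      simp [h1, h2, hu0 p hp v hv, hu0 p' hp' v hv, hy1 p hp, hy1 p' hp']
    · rw [hΦin p hp, hΦout p' hp'] at hpp
      exact absurd hpp (by simp)
    · rw [hΦout p hp, hΦin p' hp'] at hpp
      exact absurd hpp (by simp)
    · rw [hΦout p hp, hΦout p' hp', Sum.inl.injEq, ρ.symm.injective.eq_iff] at hpp
      have h1 := agree_of_span hu (fun i => congrFun hpp i) hv
      simp [h1, hq1 p hp, hq1 p' hp', hw0 p hp x hx, hw0 p' hp' x hx, hy0 p hp, hy0 p' hp']
  have hbij : Function.Bijective Φ := by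
    refine (Fintype.bijective_iff_injective_and_card Φ).2 ⟨hinj, ?_⟩
    simp only [Fintype.card_sum, Fintype.card_pi, ZMod.card, prod_const, card_univ,
      Fintype.card_fin]
    rw [pow_succ, ← hΔ]
    omega
  let g : Fin (a + 1) ⊕ (Fin (a + 1) ⊕ Unit) → ι → ZMod 2 :=
    Sum.elim u (Sum.elim z fun _ => y)
  have hg : ∀ r, overlapMatrix R r ∘ Φ = g r := by
    intro r
    funext p
    by_cases hp : p ∈ wordSupport y
    · rcases r with i | i | _
      · simp [g, overlapMatrix, hΦin p hp, hu0 p hp _ (huV i)]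
      · simp [g, overlapMatrix, appendOnes, hΦin p hp, hρ]
      · simp [g, overlapMatrix, appendOnes, hΦin p hp, hy1 p hp]
    · rcases r with i | i | _
      · simp [g, overlapMatrix, hΦout p hp, hρ]
      · refine Fin.cases ?_ (fun i => ?_) i
        · simp [g, z, overlapMatrix, hΦout p hp, hq1 p hp]
        · simp [g, z, overlapMatrix, hΦout p hp, hw0 p hp _ (hwW i)]
      · simp [g, overlapMatrix, hΦout p hp, hy0 p hp]
  have hgspan : Submodule.span (ZMod 2) (Set.range g) = C := by
    apply le_antisymm
    · rw [Submodule.span_le]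
      rintro _ ⟨i | i | _, rfl⟩
      · exact hVC (huV i)
      · refine Fin.cases ?_ (fun i => ?_) i
        · exact hq
        · exact (hWC (hwW i)).1
      · exact hyC
    · intro c hc
      obtain ⟨v, hv, b, x, hx, d, rfl⟩ := hdec c hc
      have hgm : ∀ r, g r ∈ Submodule.span (ZMod 2) (Set.range g) :=
        fun r => Submodule.subset_span ⟨r, rfl⟩
      have h1 : V ≤ Submodule.span (ZMod 2) (Set.range g) := by
        rw [← hu, Submodule.span_le]
        rintro _ ⟨i, rfl⟩
        exact hgm (Sum.inl i)
      have h2 : W ≤ Submodule.span (ZMod 2) (Set.range g) := by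
        rw [← hw, Submodule.span_le]
        rintro _ ⟨i, rfl⟩
        exact hgm (Sum.inr (Sum.inl i.succ))
      exact Submodule.add_mem _ (Submodule.add_mem _ (Submodule.add_mem _ (h1 hv)
        (Submodule.smul_mem _ _ (hgm (Sum.inr (Sum.inl 0))))) (h2 hx))
        (Submodule.smul_mem _ _ (hgm (Sum.inr (Sum.inr ()))))
  -- The rows pull back to 2a+3 words spanning a code of that dimension, so they are independent
  -- there and hence already before pulling back.
  have hli : LinearIndependent (ZMod 2) (overlapMatrix R).row := by
    have h1 : LinearIndependent (ZMod 2) g := by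
      rw [linearIndependent_iff_card_eq_finrank_span, Set.finrank, hgspan, hdim]
      simp
      omega
    refine LinearIndependent.of_comp (LinearMap.funLeft (ZMod 2) (ZMod 2) Φ) ?_
    convert h1 using 1
    exact funext hg
  refine ⟨Submodule.span (ZMod 2) (Set.range (overlapMatrix R).row), ⟨hli, rfl⟩, ?_, ?_, ?_⟩
  · have hRm : ∀ i, R i ∈ reedMullerCode (a + 1) := fun i =>
      hR.2 ▸ Submodule.subset_span ⟨Sum.inl i, rfl⟩
    have h1m : (fun _ => 1) ∈ reedMullerCode (a + 1) :=
      hR.2 ▸ Submodule.subset_span ⟨Sum.inr (), rfl⟩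
    rw [Submodule.span_le]
    rintro _ ⟨i | i | _, rfl⟩
    · exact ⟨hRm i, (reedMullerCode (a + 1)).zero_mem⟩
    · refine ⟨?_, hRm i⟩
      by_cases hi : i = 0
      · subst hi
        convert h1m using 1
        funext v
        simp [overlapMatrix, Matrix.row]
      · convert (reedMullerCode (a + 1)).zero_mem using 1
        funext v
        simp [overlapMatrix, Matrix.row, hi]
    · refine ⟨?_, h1m⟩
      convert (reedMullerCode (a + 1)).zero_mem using 1
      funext v
      simp [overlapMatrix, Matrix.row]
  · rw [finrank_directSum, finrank_reedMullerCode, finrank_span_eq_card hli]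
    simp
    omega
  · refine ⟨Equiv.ofBijective Φ hbij, fun c => ?_⟩
    change _ ↔ c ∘ Φ ∈ C
    have hcomp : ∀ x : Fin (a + 1) ⊕ (Fin (a + 1) ⊕ Unit) → ZMod 2,
        (∑ r, x r • (overlapMatrix R).row r) ∘ Φ = ∑ r, x r • g r := by
      intro x
      simp only [← hg]
      funext p
      simp [Matrix.row]
    rw [Submodule.mem_span_range_iff_exists_fun, ← hgspan,
      Submodule.mem_span_range_iff_exists_fun]
    refine exists_congr fun x => ?_
    rw [← hcomp]
    exact hbij.2.injective_comp_right.eq_iff.symm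

/-! ### Numerical consequences of the moments and the classification -/

theorem threeWeight_of_nonzeroWeights {Δ : ℕ} {C : BinaryCode ι}
    (h : C.nonzeroWeights = {Δ, 2 * Δ, 3 * Δ}) : ThreeWeight Δ C := by
  intro c hc h0
  have : hammingNorm c ∈ C.nonzeroWeights := ⟨c, hc, h0, rfl⟩
  rw [h] at this
  simpa using this

/-- The bounds and numbers obtained from the power moments if the dimension is large. -/
theorem ThreeWeight.moment_consequences {a Δ : ℕ} (hΔ : Δ = 2 ^ a) (hΔ8 : 8 ≤ Δ)
    {C : BinaryCode ι} (hC : ThreeWeight Δ C) (hfull : C.IsFullLength)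
    (hn : Fintype.card ι ≤ 4 * Δ) (hdim : 2 * a + 3 ≤ Module.finrank (ZMod 2) C) :
    4 * Δ - 3 ≤ #(wordsOfWeight C Δ) ∧
    (#(wordsOfWeight C Δ) ≤ 4 * Δ - 2 → Module.finrank (ZMod 2) C = 2 * a + 3 ∧
      Fintype.card ι = 4 * Δ ∧ C.IsProjective ∧ #(wordsOfWeight C Δ) ≤ 4 * Δ - 3) := by
  obtain ⟨m₁, m₂, m₃⟩ := hC.power_moments (by omega) hfull rfl rfl rfl rfl rfl rfl
  obtain ⟨s, hs⟩ := Nat.exists_eq_add_of_le hn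
  have hs' : (Fintype.card ι : ℤ) = 4 * Δ - s := by omega
  rw [hs'] at m₂ m₃
  obtain ⟨hA, -⟩ := number_of_minimum_weight_words m₁ m₂ m₃
  have hN := card_le_numEqualPairs C
  set A := #(wordsOfWeight C Δ) with hAdef
  set N := numEqualPairs C
  have hy : #(words C) = 8 * Δ ^ 2 * 2 ^ (Module.finrank (ZMod 2) C - (2 * a + 3)) := by
    rw [card_words, hΔ, ← pow_mul, show (8 : ℕ) = 2 ^ 3 by norm_num, ← pow_add, ← pow_add]
    congr 1
    omega
  set e := 2 ^ (Module.finrank (ZMod 2) C - (2 * a + 3)) with he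
  have hAe : (A : ℤ) = e * (s ^ 2 + 2 * Δ * s + N) - 3 := by
    have hne : (8 * Δ ^ 2 : ℤ) ≠ 0 := by
      have : (Δ : ℤ) ≠ 0 := by omega
      positivity
    refine mul_left_cancel₀ hne ?_
    rw [hA, hy]
    push_cast
    ring
  -- Since 2Δ ≥ 16 and N ≥ n = 4Δ - s, a length deficit s costs at least 15s words.
  have hsum : (4 * Δ + 15 * s : ℤ) ≤ s ^ 2 + 2 * Δ * s + N := by
    have h1 : (16 * s : ℤ) ≤ 2 * Δ * s :=
      mul_le_mul_of_nonneg_right (by omega) (Int.natCast_nonneg s)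
    have h2 : (4 * Δ - s : ℤ) ≤ N := by omega
    linarith [sq_nonneg (s : ℤ)]
  have he1 : 1 ≤ e := Nat.one_le_two_pow
  have hmul : ∀ m : ℕ, m ≤ e → m * (4 * Δ + 15 * s : ℤ) - 3 ≤ A := by
    intro m hm
    rw [hAe]
    have h1 : (m : ℤ) * (4 * Δ + 15 * s) ≤ e * (4 * Δ + 15 * s) :=
      mul_le_mul_of_nonneg_right (by exact_mod_cast hm) (by positivity)
    have h2 := mul_le_mul_of_nonneg_left hsum (Int.natCast_nonneg e)
    linarith
  have hge := hmul 1 he1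
  rw [Nat.cast_one, one_mul] at hge
  refine ⟨by omega, fun hle => ?_⟩
  have hs0 : s = 0 := by omega
  have he2 : e = 1 := by
    by_contra hne
    have := hmul 2 (by omega)
    push_cast at this
    omega
  have hdim' : Module.finrank (ZMod 2) C = 2 * a + 3 := by
    have := (Nat.pow_eq_one.1 (he ▸ he2)).resolve_left (by norm_num)
    omega
  rw [hs0, he2] at hAe
  push_cast at hAe
  -- Now A = N - 3, so A ≤ 4Δ - 2 means N ≤ n + 1, too few for a repeated position.
  have hproj : C.IsProjective := isProjective_of_numEqualPairs_le hfull (by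
    change N ≤ _
    omega)
  have hN' : N = Fintype.card ι := hproj.numEqualPairs_eq
  exact ⟨hdim', by omega, hproj, by omega⟩

/-- The weight distribution of a projective code of dimension `2a + 3` and length `4Δ - s`. -/
theorem ThreeWeight.weight_distribution {a Δ : ℕ} (hΔ : Δ = 2 ^ a) {C : BinaryCode ι}
    (hC : ThreeWeight Δ C) (hproj : C.IsProjective) {s : ℤ}
    (hn : (Fintype.card ι : ℤ) = 4 * Δ - s) (hdim : Module.finrank (ZMod 2) C = 2 * a + 3) :
    (#(wordsOfWeight C Δ) : ℤ) = s ^ 2 + 2 * Δ * s + 4 * Δ - s - 3 ∧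
    (#(wordsOfWeight C (3 * Δ)) : ℤ) = s ^ 2 - 2 * Δ * s + 4 * Δ - s - 1 ∧
    (#(wordsOfWeight C (2 * Δ)) : ℤ) = 8 * Δ ^ 2 - 2 * s ^ 2 - 8 * Δ + 2 * s + 3 := by
  have hΔ0 : 0 < Δ := hΔ ▸ by positivity
  have hne : (Δ : ℤ) ≠ 0 := by omega
  obtain ⟨m₁, m₂, m₃⟩ := hC.power_moments hΔ0 hproj.1 rfl rfl rfl rfl rfl rfl
  rw [hn] at m₂ m₃
  obtain ⟨hA, hA'⟩ := number_of_minimum_weight_words m₁ m₂ m₃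
  have hy : #(words C) = 8 * Δ ^ 2 := by
    rw [card_words, hΔ, ← pow_mul, show (8 : ℕ) = 2 ^ 3 by norm_num, ← pow_add, hdim]
    congr 1
    omega
  rw [hproj.numEqualPairs_eq, hn, hy] at hA
  rw [hy] at hA' m₁
  push_cast at hA hA' m₁
  have h1 : (#(wordsOfWeight C Δ) : ℤ) = s ^ 2 + 2 * Δ * s + 4 * Δ - s - 3 := by
    refine mul_left_cancel₀ (show (8 * Δ ^ 2 : ℤ) ≠ 0 by positivity) ?_
    rw [hA]
    ring
  have h3 : (#(wordsOfWeight C (3 * Δ)) : ℤ) = s ^ 2 - 2 * Δ * s + 4 * Δ - s - 1 := by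
    refine mul_left_cancel₀ (show (2 * Δ : ℤ) ≠ 0 by positivity) ?_
    linear_combination -hA' + 2 * (Δ : ℤ) * h1
  exact ⟨h1, h3, by linear_combination -m₁ - h1 - h3⟩

/-- The classification of the codes of dimension at least `2a + 3`. -/
theorem large_code_classification (C : BinaryCode ι) (a Δ : ℕ) (ha : 3 ≤ a) (hΔ : Δ = 2 ^ a)
    (hfull : C.IsFullLength) (hC : ThreeWeight Δ C)
    (hn₂ : Fintype.card ι ≤ 4 * Δ) (hdim : 2 * a + 3 ≤ Module.finrank (ZMod 2) C) :
    Module.finrank (ZMod 2) C = 2 * a + 3 ∧ C.IsProjective ∧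
      ((Fintype.card ι + 1 = 4 * Δ ∧
        C.Isomorphic (directSum (simplexCode (a + 1)) (reedMullerCode (a + 1)))) ∨
      (Fintype.card ι = 4 * Δ ∧
        ∀ R : Matrix (Fin (a + 1)) (Fin (a + 1) → ZMod 2) (ZMod 2),
          IsGeneratorMatrix (appendOnes R) (reedMullerCode (a + 1)) →
          ∃ D : BinaryCode ((Fin (a + 1) → ZMod 2) ⊕ (Fin (a + 1) → ZMod 2)),
            IsGeneratorMatrix (overlapMatrix R) D ∧
            D ≤ directSum (reedMullerCode (a + 1)) (reedMullerCode (a + 1)) ∧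
            Module.finrank (ZMod 2) (directSum (reedMullerCode (a + 1)) (reedMullerCode (a + 1)))
              = Module.finrank (ZMod 2) D + 1 ∧
            C.Isomorphic D)) := by
  have hΔ8 : 8 ≤ Δ := by
    rw [hΔ]
    exact Nat.pow_le_pow_right (n := 2) (by norm_num) ha
  obtain ⟨hN, hcons⟩ := hC.moment_consequences hΔ hΔ8 hfull hn₂ hdim
  rcases hC.exists_large_subcode hΔ8 (by rwa [hfull.codeSupport_eq, Finset.card_univ]) hN with
    ⟨V, hVC, hV, hM, y, hy⟩ | ⟨hle, hex⟩
  · obtain ⟨h1, h2⟩ := hC.finrank_le_of_reedMuller hΔ (by omega) hfull hVC hV hM hy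
    have hdim' := le_antisymm h1 hdim
    obtain ⟨-, hcard, -, hproj⟩ := h2 hdim'
    exact ⟨hdim', hproj, Or.inl ⟨hcard,
      hC.isomorphic_directSum hΔ (by omega) hfull hVC hV hM hy hdim'⟩⟩
  · obtain ⟨hdim', hcard, hproj, hle'⟩ := hcons hle
    obtain ⟨V, hVC, W, hWC, hV, hW, hM, hM', y, hy⟩ := hex hle'
    exact ⟨hdim', hproj, Or.inr ⟨hcard, fun R hR =>
      exists_overlap_code hΔ (by omega) hC hproj hcard hdim' hVC hWC hV hW hM hM' hy hR⟩⟩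

end BinaryCode

theorem mainTheorem4 (a Δ n : ℕ) (ha : 3 ≤ a) (hΔ : Δ = 2 ^ a)
    (C : BinaryCode (Fin n)) (hfull : C.IsFullLength)
    (hweights : C.nonzeroWeights = {Δ, 2 * Δ, 3 * Δ})
    (hn₁ : 3 * Δ ≤ n) (hn₂ : n ≤ 4 * Δ) :
    Module.finrank (ZMod 2) C ≤ 2 * a + 3 ∧
    (Module.finrank (ZMod 2) C = 2 * a + 3 →
      (n = 4 * Δ - 1 ∨ n = 4 * Δ) ∧
      C.IsProjective ∧
      (n = 4 * Δ - 1 →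
        C.Isomorphic (BinaryCode.directSum (BinaryCode.simplexCode (a + 1))
          (BinaryCode.reedMullerCode (a + 1))) ∧
        C.weightEnumerator =
          1 + Polynomial.C (6 * (Δ : ℤ) - 3) * Polynomial.X ^ Δ
            + Polynomial.C (8 * (Δ : ℤ) ^ 2 - 8 * (Δ : ℤ) + 3) * Polynomial.X ^ (2 * Δ)
            + Polynomial.C (2 * (Δ : ℤ) - 1) * Polynomial.X ^ (3 * Δ)) ∧
      (n = 4 * Δ →
        (∀ R : Matrix (Fin (a + 1)) (Fin (a + 1) → ZMod 2) (ZMod 2),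
          BinaryCode.IsGeneratorMatrix (BinaryCode.appendOnes R)
            (BinaryCode.reedMullerCode (a + 1)) →
          ∃ D : BinaryCode ((Fin (a + 1) → ZMod 2) ⊕ (Fin (a + 1) → ZMod 2)),
            BinaryCode.IsGeneratorMatrix (BinaryCode.overlapMatrix R) D ∧
            D ≤ BinaryCode.directSum (BinaryCode.reedMullerCode (a + 1))
              (BinaryCode.reedMullerCode (a + 1)) ∧
            Module.finrank (ZMod 2) (BinaryCode.directSum (BinaryCode.reedMullerCode (a + 1))
              (BinaryCode.reedMullerCode (a + 1))) = Module.finrank (ZMod 2) D + 1 ∧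
            C.Isomorphic D) ∧
        C.weightEnumerator =
          1 + Polynomial.C (4 * (Δ : ℤ) - 3) * Polynomial.X ^ Δ
            + Polynomial.C (8 * (Δ : ℤ) ^ 2 - 8 * (Δ : ℤ) + 3) * Polynomial.X ^ (2 * Δ)
            + Polynomial.C (4 * (Δ : ℤ) - 1) * Polynomial.X ^ (3 * Δ))) := by
  have hΔ0 : 0 < Δ := hΔ ▸ by positivity
  have hC := BinaryCode.threeWeight_of_nonzeroWeights hweights
  have hcardn : Fintype.card (Fin n) = n := Fintype.card_fin n
  have hmain := C.large_code_classification a Δ ha hΔ hfull hC (by rwa [hcardn])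
  rw [hcardn] at hmain
  constructor
  -- The classification covers every dimension from 2a+3 on and returns equality, which is the upper
  -- bound.
  · by_contra hlt
    have := (hmain (by omega)).1
    omega
  intro hdim
  obtain ⟨-, hproj, hcases⟩ := hmain hdim.ge
  have hW := hC.weightEnumerator_eq hΔ0 (by rwa [hcardn])
  refine ⟨by omega, hproj, fun hn => ⟨?_, ?_⟩, fun hn => ⟨?_, ?_⟩⟩
  · rcases hcases with h | h
    · exact h.2
    · omega
  · obtain ⟨h1, h3, h2⟩ := hC.weight_distribution hΔ hproj (s := 1) (by rw [hcardn]; omega) hdim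
    rw [hW, h1, h2, h3]
    ring_nf
  · rcases hcases with h | h
    · omega
    · exact h.2
  · obtain ⟨h1, h3, h2⟩ := hC.weight_distribution hΔ hproj (s := 0) (by rw [hcardn]; omega) hdim
    rw [hW, h1, h2, h3]
    ring_nf
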